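/- Let $(M^m,g)$ and $(N^n,h)$ be smooth Riemannian manifolds (without boundary), let $f:M\to(0,\infty)$ be a smooth function and let $\varphi:M\to N$ be a smooth map. For $x\in M$ put $V_x=\ker d\varphi_x$ (vertical vectors) and $H_x=V_x^{\perp}$ (horizontal vectors). Suppose that $\varphi$ is horizontally weakly conformal with dilation $\lambda:M\to[0,\infty)$: if $d\varphi_x=0$ then $\lambda(x)=0$; if $d\varphi_x\neq 0$ then $d\varphi_x|_{H_x}:H_x\to T_{\varphi(x)}N$ is surjective, $\lambda(x)>0$, and $h(d\varphi_x X,d\varphi_x Y)=\lambda(x)^2 g(X,Y)$ for all $X,Y\in H_x$. The map $\varphi$ is called $f$-harmonic if it satisfies the $f$-harmonic map equation $\tau_f(\varphi):=f\,\tau(\varphi)+d\varphi(\operatorname{grad} f)=0$ on $M$ (the Euler–Lagrange equation of $\frac12\int f|d\varphi|^2\,dv_g$), where $\tau(\varphi)=\operatorname{Tr}_g\nabla d\varphi$ is the tension field. It is called an $f$-harmonic morphism if it is continuous and, for every open $V\subseteq N$ with $\varphi^{-1}(V)\ne\emptyset$ and every harmonic function $u:V\to\mathbb R$ (of class $C^2$,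 $\Delta^N u=0$), the function $u\circ\varphi$ is $C^2$ and satisfies $f\Delta^M(u\circ\varphi)+g(\operatorname{grad} f,\operatorname{grad}(u\circ\varphi))=0$ on $\varphi^{-1}(V)$. Then any two of the following conditions imply the third: 1. $\varphi$ is an $f$-harmonic map; 2. $\operatorname{grad}(f\lambda^{2-n})$ is vertical, that is, $d\varphi_x(\operatorname{grad}(f\lambda^{2-n}))=0$ at every point $x$ with $d\varphi_x\neq0$; 3. $\varphi$ has minimal fibers, that is, the mean curvature vector of the fiber of $\varphi$ through $x$ vanishes at every point $x$ at which $d\varphi_x$ is surjective. Moreover, if (1) holds, then $\varphi$ is an $f$-harmonic morphism. -/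

import Mathlib

open Bundle Manifold Set
open scoped ContDiff Topology

noncomputable section

namespace FHarmonic

section OneManifold

/-! ### Riemannian geometry of one manifold

`M` is a smooth manifold without boundary, modelled on the finite-dimensional space `E`; its
Riemannian metric is given by the inner products on the tangent spaces. Recall that
`TangentSpace 𝓘(ℝ, E) x` is `E`, a tangent vector at `x` being identified with its coordinates in
the preferred chart `extChartAt 𝓘(ℝ, E) x` at `x`. -/

variable {E : Type*} [NormedAddCommGroup E] [NormedSpace ℝ E] [FiniteDimensional ℝ E]
  {M : Type*} [TopologicalSpace M] [ChartedSpace E M]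

instance (x : M) : FiniteDimensional ℝ (TangentSpace 𝓘(ℝ, E) x) :=
  inferInstanceAs (FiniteDimensional ℝ E)

variable [RiemannianBundle (fun x : M ↦ TangentSpace 𝓘(ℝ, E) x)]

/-- The metric in the chart at `p`: at the point with coordinates `y` it is the bilinear form
`g_{ij}(y)`, i.e. the pull-back of the metric by the inverse of the chart. -/
def chartMetric (p : M) (y : E) : E →L[ℝ] E →L[ℝ] ℝ :=
  let A : E →L[ℝ] TangentSpace 𝓘(ℝ, E) ((extChartAt 𝓘(ℝ, E) p).symm y) :=
    mfderiv 𝓘(ℝ, E) 𝓘(ℝ, E) (extChartAt 𝓘(ℝ, E) p).symm y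
  (innerSL ℝ (E := TangentSpace 𝓘(ℝ, E) ((extChartAt 𝓘(ℝ, E) p).symm y))).bilinearComp A A

/-- The Christoffel symbols of the Levi-Civita connection in the chart at `p`, as a bilinear map:
`Γ(v, w)^k = ½ g^{kl} (∂_i g_{jl} + ∂_j g_{il} - ∂_l g_{ij}) v^i w^j`. -/
def christoffel (p : M) (y : E) (v w : E) : E :=
  (chartMetric p y).inverse ((1 / 2 : ℝ) •
    (fderiv ℝ (chartMetric p) y v w + fderiv ℝ (chartMetric p) y w v
      - ((fderiv ℝ (chartMetric p) y).flip v).flip w))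

/-- The Levi-Civita covariant derivative `∇_v W` at `x` of a vector field `W`, namely
`v^i ∂_i W^k + Γ^k_{ij} v^i W^j` in the chart at `x`. -/
def covDeriv (W : Π y : M, TangentSpace 𝓘(ℝ, E) y) (x : M) (v : TangentSpace 𝓘(ℝ, E) x) :
    TangentSpace 𝓘(ℝ, E) x :=
  let e := extChartAt 𝓘(ℝ, E) x
  let W' : E → E := fun y ↦ mfderiv 𝓘(ℝ, E) 𝓘(ℝ, E) e (e.symm y) (W (e.symm y))
  fderiv ℝ W' (e x) v + christoffel x (e x) v (W x)

/-- The gradient of a real function: `⟨grad u, v⟩ = du(v)`. -/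
def grad (u : M → ℝ) (x : M) : TangentSpace 𝓘(ℝ, E) x :=
  (InnerProductSpace.toDual ℝ (TangentSpace 𝓘(ℝ, E) x)).symm (mvfderiv 𝓘(ℝ, E) u x)

/-- The trace, with respect to the metric, of a function of two tangent vectors at `x` (which will
be a bilinear map): `∑ B(e_i, e_i)` over an orthonormal basis `e_i` of the tangent space. -/
def trace {G : Type*} [AddCommGroup G] (x : M)
    (B : TangentSpace 𝓘(ℝ, E) x → TangentSpace 𝓘(ℝ, E) x → G) : G :=
  ∑ i, B (stdOrthonormalBasis ℝ (TangentSpace 𝓘(ℝ, E) x) i)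
    (stdOrthonormalBasis ℝ (TangentSpace 𝓘(ℝ, E) x) i)

variable (E) in
/-- The Hessian `∇du` of a real function, `(∂_i ∂_j u - Γ^k_{ij} ∂_k u) v^i w^j`. -/
def hessian (u : M → ℝ) (x : M) (v w : TangentSpace 𝓘(ℝ, E) x) : ℝ :=
  let e := extChartAt 𝓘(ℝ, E) x
  let u' : E → ℝ := u ∘ e.symm
  fderiv ℝ (fderiv ℝ u') (e x) v w - fderiv ℝ u' (e x) (christoffel x (e x) v w)

variable (E) in
/-- The Laplace–Beltrami operator `Δu = Tr_g ∇du`. -/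
def laplacian (u : M → ℝ) (x : M) : ℝ := trace x (hessian E u x)

variable (E) in
/-- `u` is a harmonic function on `V`. -/
def IsHarmonicOn (u : M → ℝ) (V : Set M) : Prop :=
  ContMDiffOn 𝓘(ℝ, E) 𝓘(ℝ, ℝ) 2 u V ∧ ∀ x ∈ V, laplacian E u x = 0

variable (E) in
/-- `u` is an `f`-harmonic function on `U`: it is `C²` and `f Δu + ⟨grad f, grad u⟩ = 0`. -/
def IsFHarmonicOn (f u : M → ℝ) (U : Set M) : Prop :=
  ContMDiffOn 𝓘(ℝ, E) 𝓘(ℝ, ℝ) 2 u U ∧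
    ∀ x ∈ U, f x * laplacian E u x + inner ℝ (grad (E := E) f x) (grad (E := E) u x) = 0

end OneManifold

section Maps

/-! ### Maps between Riemannian manifolds -/

variable {E : Type*} [NormedAddCommGroup E] [NormedSpace ℝ E] [FiniteDimensional ℝ E]
  {M : Type*} [TopologicalSpace M] [ChartedSpace E M]
  [RiemannianBundle (fun x : M ↦ TangentSpace 𝓘(ℝ, E) x)]
  {F : Type*} [NormedAddCommGroup F] [NormedSpace ℝ F] [FiniteDimensional ℝ F]
  {N : Type*} [TopologicalSpace N] [ChartedSpace F N]
  [RiemannianBundle (fun y : N ↦ TangentSpace 𝓘(ℝ, F) y)]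

/-- The differential `dφ_x : T_x M → T_{φ(x)} N`. -/
abbrev differential (φ : M → N) (x : M) :
    TangentSpace 𝓘(ℝ, E) x →L[ℝ] TangentSpace 𝓘(ℝ, F) (φ x) :=
  mfderiv 𝓘(ℝ, E) 𝓘(ℝ, F) φ x

/-- The second fundamental form `∇dφ` of a map, in the charts at `x` and at `φ x`:
`(∂_i ∂_j φ^γ - Γ^k_{ij} ∂_k φ^γ + Γ'^γ_{αβ} ∂_i φ^α ∂_j φ^β) v^i w^j`. -/
def secondFundamentalForm (φ : M → N) (x : M) (v w : TangentSpace 𝓘(ℝ, E) x) :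
    TangentSpace 𝓘(ℝ, F) (φ x) :=
  let e := extChartAt 𝓘(ℝ, E) x
  let e' := extChartAt 𝓘(ℝ, F) (φ x)
  let φ' : E → F := e' ∘ φ ∘ e.symm
  fderiv ℝ (fderiv ℝ φ') (e x) v w - fderiv ℝ φ' (e x) (christoffel x (e x) v w)
    + christoffel (φ x) (e' (φ x)) (fderiv ℝ φ' (e x) v) (fderiv ℝ φ' (e x) w)

/-- The tension field `τ(φ) = Tr_g ∇dφ`. -/
def tensionField (φ : M → N) (x : M) : TangentSpace 𝓘(ℝ, F) (φ x) :=
  trace x (secondFundamentalForm (E := E) (F := F) φ x)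

/-- The `f`-tension field `τ_f(φ) = f τ(φ) + dφ(grad f)`. -/
def fTensionField (f : M → ℝ) (φ : M → N) (x : M) : TangentSpace 𝓘(ℝ, F) (φ x) :=
  f x • tensionField (E := E) (F := F) φ x + differential (E := E) (F := F) φ x (grad f x)

variable (E F) in
/-- `φ` is an `f`-harmonic map, i.e. it satisfies the `f`-harmonic map equation `τ_f(φ) = 0`
(the Euler–Lagrange equation of the energy `½ ∫ f |dφ|²`). -/
def IsFHarmonicMap (f : M → ℝ) (φ : M → N) : Prop :=
  ∀ x, fTensionField (E := E) (F := F) f φ x = 0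

variable (E F) in
/-- `φ` is an `f`-harmonic morphism: it is continuous and pulls back harmonic functions on open
sets of `N` to `f`-harmonic functions. -/
def IsFHarmonicMorphism (f : M → ℝ) (φ : M → N) : Prop :=
  Continuous φ ∧ ∀ (V : Set N) (u : N → ℝ), IsOpen V → (φ ⁻¹' V).Nonempty →
    IsHarmonicOn F u V → IsFHarmonicOn E f (u ∘ φ) (φ ⁻¹' V)

/-- The vertical space `V_x = ker dφ_x`. -/
def verticalSpace (φ : M → N) (x : M) : Submodule ℝ (TangentSpace 𝓘(ℝ, E) x) :=
  LinearMap.ker (differential (E := E) (F := F) φ x).toLinearMap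

/-- The horizontal space `H_x`, the orthogonal complement of `V_x`. -/
def horizontalSpace (φ : M → N) (x : M) : Submodule ℝ (TangentSpace 𝓘(ℝ, E) x) :=
  (verticalSpace (E := E) (F := F) φ x)ᗮ

variable (E F) in
/-- `φ` is horizontally weakly conformal: wherever `dφ_x ≠ 0`, the restriction of `dφ_x` to the
horizontal space is surjective and conformal. -/
def IsHorizontallyWeaklyConformal (φ : M → N) : Prop :=
  ∀ x, differential (E := E) (F := F) φ x ≠ 0 →
    SurjOn (differential (E := E) (F := F) φ x) (horizontalSpace (E := E) (F := F) φ x) univ ∧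
    ∃ c : ℝ, 0 < c ∧ ∀ v ∈ horizontalSpace (E := E) (F := F) φ x,
      ∀ w ∈ horizontalSpace (E := E) (F := F) φ x,
        inner ℝ (differential (E := E) (F := F) φ x v) (differential (E := E) (F := F) φ x w)
          = c ^ 2 * inner ℝ v w

variable (E F) in
/-- `lam` is the dilation of the horizontally weakly conformal map `φ`: it vanishes where
`dφ_x = 0`, and elsewhere `lam x > 0` is the conformal factor of `dφ_x` on the horizontal space. -/
def IsDilation (φ : M → N) (lam : M → ℝ) : Prop :=
  ∀ x, (differential (E := E) (F := F) φ x = 0 → lam x = 0) ∧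
    (differential (E := E) (F := F) φ x ≠ 0 → 0 < lam x ∧
      ∀ v ∈ horizontalSpace (E := E) (F := F) φ x, ∀ w ∈ horizontalSpace (E := E) (F := F) φ x,
        inner ℝ (differential (E := E) (F := F) φ x v) (differential (E := E) (F := F) φ x w)
          = lam x ^ 2 * inner ℝ v w)

variable [IsManifold 𝓘(ℝ, E) ∞ M]

/-- The vertical vector field, defined near `x`, obtained from `w` by taking the vector field with
constant coordinates in the chart at `x` and projecting it orthogonally to the vertical spaces.
If `w` is vertical then it extends `w`. -/
def verticalExtension (φ : M → N) (x : M) (w : TangentSpace 𝓘(ℝ, E) x) (y : M) :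
    TangentSpace 𝓘(ℝ, E) y :=
  (verticalSpace (E := E) (F := F) φ y).starProjection
    (FiberBundle.extend E (E := fun z : M ↦ TangentSpace 𝓘(ℝ, E) z) w y)

/-- The second fundamental form at `x` of the fiber of `φ` through `x` (for `v, w` in `V_x`):
the horizontal part, i.e. the part normal to the fiber, of `∇_v W`, where `W` is a vertical vector
field that extends `w`. -/
def fiberSecondFundamentalForm (φ : M → N) (x : M) (v w : TangentSpace 𝓘(ℝ, E) x) :
    TangentSpace 𝓘(ℝ, E) x :=
  (horizontalSpace (E := E) (F := F) φ x).starProjection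
    (covDeriv (verticalExtension (E := E) (F := F) φ x w) x v)

/-- The mean curvature vector at `x` of the fiber of `φ` through `x`: the trace of its second
fundamental form, divided by its dimension (and zero if the fiber is discrete). -/
def fiberMeanCurvature (φ : M → N) (x : M) : TangentSpace 𝓘(ℝ, E) x :=
  let b := stdOrthonormalBasis ℝ (verticalSpace (E := E) (F := F) φ x)
  (Module.finrank ℝ (verticalSpace (E := E) (F := F) φ x) : ℝ)⁻¹ •
    ∑ i, fiberSecondFundamentalForm (E := E) (F := F) φ x (b i) (b i)

variable (E F) in
/-- `φ` has minimal fibers: the mean curvature of the fibers vanishes at every point where `φ` is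
a submersion (near such a point the fiber is a submanifold). -/
def HasMinimalFibers (φ : M → N) : Prop :=
  ∀ x, Function.Surjective (differential (E := E) (F := F) φ x) →
    fiberMeanCurvature (E := E) (F := F) φ x = 0

variable (E F) in
/-- The gradient of `u` is vertical at every point where `dφ_x ≠ 0`. (It is only there that
`u = f λ^{2-n}` is sure to be defined and smooth; where `dφ_x = 0` every vector is vertical.) -/
def GradIsVertical (φ : M → N) (u : M → ℝ) : Prop :=
  ∀ x, differential (E := E) (F := F) φ x ≠ 0 →
    grad u x ∈ verticalSpace (E := E) (F := F) φ x

end Maps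

end FHarmonic

end

/-! At a point with dφ ≠ 0 write A = dφ and n = dim N. Everything rests on one identity,
`fTensionField_eq`: τ_f(φ) = -f A(T) + λ^(n-2) A(grad(f λ^(2-n))), where T is the trace of the
second fundamental form of the fiber. T is horizontal, so A(T) = 0 exactly when T = 0, i.e. when the
mean curvature vanishes. Since f and λ are positive there, the vanishing of any two of the three
terms forces that of the third.

The identity comes from splitting the trace of ∇dφ. On vertical vectors, differentiating A(W) = 0
for a vertical field W gives A(∇_v W) = -∇dφ(v, W). On horizontal vectors, conformality is the
equation A A* = λ² id; its derivative (`sff_adjoint_add`), combined with the symmetry of ∇dφ, yields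
the factor 1 - n/2 in front of dλ² (`sum_sff_adjoint`). This term and A(grad f) together form the
gradient of f λ^(2-n).

Where dφ = 0, conditions 2 and 3 carry no information. Such a point is either a limit of regular
points, where τ_f = 0 by continuity, or interior to the critical set, where all derivatives entering
τ_f vanish. Continuity needs proof because ∇dφ at each point is computed in the charts centred
there: `sff_coordMap_chartDeriv` gives independence of charts, from the composition formula and the
fact that chart transitions are isometries.

The morphism property follows from Δ(u ∘ φ) = du(τ(φ)) + λ² (Δu) ∘ φ, which makes the f-Laplacian of
u ∘ φ equal to du(τ_f(φ)) + f λ² (Δu) ∘ φ. -/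

set_option maxSynthPendingDepth 3
set_option linter.unusedSectionVars false

namespace FHarmonic

/-! ### Metrics, Christoffel symbols and second fundamental forms in coordinates -/

section Coordinates

variable {E F G : Type*} [NormedAddCommGroup E] [NormedSpace ℝ E]
  [NormedAddCommGroup F] [NormedSpace ℝ F] [NormedAddCommGroup G] [NormedSpace ℝ G]

/-- The Christoffel symbols of a metric given in coordinates. -/
noncomputable def christoffelOf (g : E → E →L[ℝ] E →L[ℝ] ℝ) (y v w : E) : E :=
  (g y).inverse ((1 / 2 : ℝ) •
    (fderiv ℝ g y v w + fderiv ℝ g y w v - ((fderiv ℝ g y).flip v).flip w))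

/-- The second fundamental form `∇dψ` of a map between spaces with metrics `g` and `h`. -/
noncomputable def sff (g : E → E →L[ℝ] E →L[ℝ] ℝ) (h : F → F →L[ℝ] F →L[ℝ] ℝ) (ψ : E → F)
    (y v w : E) : F :=
  fderiv ℝ (fderiv ℝ ψ) y v w - fderiv ℝ ψ y (christoffelOf g y v w)
    + christoffelOf h (ψ y) (fderiv ℝ ψ y v) (fderiv ℝ ψ y w)

/-- `g` is a `C¹` Riemannian metric near `y`. -/
structure IsMetricAt (g : E → E →L[ℝ] E →L[ℝ] ℝ) (y : E) : Prop where
  contDiffAt : ContDiffAt ℝ 1 g y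
  symm : ∀ᶠ z in 𝓝 y, ∀ v w, g z v w = g z w v
  pos : ∀ᶠ z in 𝓝 y, ∀ v, v ≠ 0 → 0 < g z v v

theorem isInvertible_of_pos [FiniteDimensional ℝ E] {b : E →L[ℝ] E →L[ℝ] ℝ}
    (hb : ∀ v, v ≠ 0 → 0 < b v v) : b.IsInvertible := by
  have hinj : Function.Injective b.toLinearMap := by
    rw [injective_iff_map_eq_zero]
    intro v hv
    by_contra hne
    have h1 := hb v hne
    have h2 : b v = 0 := hv
    simp [h2] at h1
  have hrank : Module.finrank ℝ E = Module.finrank ℝ (E →L[ℝ] ℝ) := by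
    rw [← (LinearMap.toContinuousLinearMap (𝕜 := ℝ) (E := E) (F' := ℝ)).finrank_eq]
    exact Subspace.dual_finrank_eq.symm
  refine ⟨(LinearEquiv.ofInjectiveOfFinrankEq b.toLinearMap hinj
    hrank).toContinuousLinearEquiv, ?_⟩
  ext v w
  rfl

theorem apply_inverse_of_isInvertible {b : E →L[ℝ] F} (hb : b.IsInvertible) (ℓ : F) :
    b (b.inverse ℓ) = ℓ := by
  obtain ⟨e, rfl⟩ := hb
  simp

theorem inverse_apply_of_isInvertible {b : E →L[ℝ] F} (hb : b.IsInvertible) (v : E) :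
    b.inverse (b v) = v := by
  obtain ⟨e, rfl⟩ := hb
  simp

theorem eq_of_forall_apply_eq {b : E →L[ℝ] E →L[ℝ] ℝ}
    (hb : ∀ v, v ≠ 0 → 0 < b v v) {v w : E} (h : ∀ z, b v z = b w z) : v = w := by
  by_contra hne
  have h1 := hb (v - w) (sub_ne_zero.2 hne)
  simp [h] at h1

namespace IsMetricAt

variable {g : E → E →L[ℝ] E →L[ℝ] ℝ} {y : E}

theorem symm_self (hg : IsMetricAt g y) (v w : E) : g y v w = g y w v :=
  hg.symm.self_of_nhds v w

theorem pos_self (hg : IsMetricAt g y) (v : E) (hv : v ≠ 0) : 0 < g y v v :=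
  hg.pos.self_of_nhds v hv

theorem differentiableAt (hg : IsMetricAt g y) : DifferentiableAt ℝ g y :=
  hg.contDiffAt.differentiableAt one_ne_zero

theorem hasFDerivAt_apply (hg : IsMetricAt g y) (v w : E) :
    HasFDerivAt (fun z ↦ g z v w) (((fderiv ℝ g y).flip v).flip w) y := by
  have h := (hg.differentiableAt.hasFDerivAt.clm_apply (hasFDerivAt_const v y)).clm_apply
    (hasFDerivAt_const w y)
  convert! h using 1
  ext z
  simp

theorem fderiv_symm (hg : IsMetricAt g y) (z v w : E) :
    fderiv ℝ g y z v w = fderiv ℝ g y z w v := by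
  have h1 := hg.hasFDerivAt_apply v w
  have h2 : HasFDerivAt (fun z ↦ g z v w) (((fderiv ℝ g y).flip w).flip v) y :=
    (hg.hasFDerivAt_apply w v).congr_of_eventuallyEq (hg.symm.mono fun z hz ↦ hz v w)
  have h3 := h1.unique h2
  simpa using DFunLike.congr_fun h3 z

theorem isInvertible [FiniteDimensional ℝ E] (hg : IsMetricAt g y) : (g y).IsInvertible :=
  isInvertible_of_pos hg.pos_self

/-- The Koszul formula. Pairing with the metric removes the inverse, so identities for Christoffel
symbols reduce to linear algebra in the derivatives of g. -/
theorem apply_christoffelOf [FiniteDimensional ℝ E] (hg : IsMetricAt g y) (v w z : E) :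
    g y (christoffelOf g y v w) z
      = 1 / 2 * (fderiv ℝ g y v w z + fderiv ℝ g y w v z - fderiv ℝ g y z v w) := by
  rw [christoffelOf, apply_inverse_of_isInvertible hg.isInvertible]
  simp

theorem christoffelOf_symm [FiniteDimensional ℝ E] (hg : IsMetricAt g y) (v w : E) :
    christoffelOf g y v w = christoffelOf g y w v := by
  refine eq_of_forall_apply_eq hg.pos_self fun z ↦ ?_
  rw [hg.apply_christoffelOf, hg.apply_christoffelOf, hg.fderiv_symm z v w]
  ring

/-- The Levi-Civita connection is compatible with the metric. -/
theorem fderiv_apply [FiniteDimensional ℝ E] (hg : IsMetricAt g y) (z v w : E) :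
    fderiv ℝ g y z v w
      = g y (christoffelOf g y z v) w + g y (christoffelOf g y z w) v := by
  rw [hg.apply_christoffelOf, hg.apply_christoffelOf, hg.fderiv_symm z w v,
    hg.fderiv_symm v z w, hg.fderiv_symm w z v]
  ring

theorem continuousAt_christoffelOf [FiniteDimensional ℝ E] {X : Type*} [TopologicalSpace X]
    {x : X} {η v w : X → E} (hg : IsMetricAt g (η x)) (hη : ContinuousAt η x)
    (hv : ContinuousAt v x) (hw : ContinuousAt w x) :
    ContinuousAt (fun x ↦ christoffelOf g (η x) (v x) (w x)) x := by
  have hD : ContinuousAt (fun x ↦ fderiv ℝ g (η x)) x :=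
    ((hg.contDiffAt.fderiv_right (m := 0) le_rfl).continuousAt).comp_of_eq hη rfl
  have hi : ContinuousAt (fun x ↦ (g (η x)).inverse) x :=
    ContinuousAt.comp_of_eq (f := fun x ↦ g (η x))
      ((hg.isInvertible.contDiffAt_map_inverse (n := 0)).continuousAt)
      (hg.contDiffAt.continuousAt.comp_of_eq hη rfl) rfl
  have hflip : ContinuousAt (fun x ↦ ((fderiv ℝ g (η x)).flip (v x)).flip (w x)) x := by
    have h1 : ContinuousAt (fun x ↦ (fderiv ℝ g (η x)).flip) x :=
      (ContinuousLinearMap.flipₗᵢ ℝ E E (E →L[ℝ] ℝ)).continuous.continuousAt.comp hD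
    have h2 : ContinuousAt (fun x ↦ ((fderiv ℝ g (η x)).flip (v x)).flip) x :=
      (ContinuousLinearMap.flipₗᵢ ℝ E E ℝ).continuous.continuousAt.comp (h1.clm_apply hv)
    exact h2.clm_apply hw
  unfold christoffelOf
  refine hi.clm_apply ?_
  exact ((((hD.clm_apply hv).clm_apply hw).add
    ((hD.clm_apply hw).clm_apply hv)).sub hflip).const_smul (1 / 2 : ℝ)

end IsMetricAt

section Christoffel

variable {g : E → E →L[ℝ] E →L[ℝ] ℝ} {h : F → F →L[ℝ] F →L[ℝ] ℝ} {k : G → G →L[ℝ] G →L[ℝ] ℝ}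
  {ψ : E → F} {χ : F → G} {y : E}

theorem christoffelOf_add_left (g : E → E →L[ℝ] E →L[ℝ] ℝ) (y v v' w : E) :
    christoffelOf g y (v + v') w = christoffelOf g y v w + christoffelOf g y v' w := by
  unfold christoffelOf
  rw [← map_add, ← smul_add]
  congr 2
  ext z
  simp
  ring

theorem christoffelOf_smul_left (g : E → E →L[ℝ] E →L[ℝ] ℝ) (y : E) (c : ℝ) (v w : E) :
    christoffelOf g y (c • v) w = c • christoffelOf g y v w := by
  unfold christoffelOf
  rw [← map_smul, smul_comm]
  congr 2
  ext z
  simp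
  ring

theorem christoffelOf_add_right (g : E → E →L[ℝ] E →L[ℝ] ℝ) (y v w w' : E) :
    christoffelOf g y v (w + w') = christoffelOf g y v w + christoffelOf g y v w' := by
  unfold christoffelOf
  rw [← map_add, ← smul_add]
  congr 2
  ext z
  simp
  ring

theorem christoffelOf_smul_right (g : E → E →L[ℝ] E →L[ℝ] ℝ) (y : E) (c : ℝ) (v w : E) :
    christoffelOf g y v (c • w) = c • christoffelOf g y v w := by
  unfold christoffelOf
  rw [← map_smul, smul_comm]
  congr 2
  ext z
  simp
  ring

/-- The second fundamental form as a bilinear map. -/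
noncomputable def sffₗ (g : E → E →L[ℝ] E →L[ℝ] ℝ) (h : F → F →L[ℝ] F →L[ℝ] ℝ) (ψ : E → F)
    (y : E) : E →ₗ[ℝ] E →ₗ[ℝ] F :=
  LinearMap.mk₂ ℝ (sff g h ψ y)
    (fun v v' w ↦ by simp only [sff, map_add, christoffelOf_add_left,
      _root_.add_apply]; abel)
    (fun c v w ↦ by simp only [sff, map_smul, christoffelOf_smul_left,
      _root_.smul_apply, smul_add, smul_sub])
    (fun v w w' ↦ by simp only [sff, map_add, christoffelOf_add_right]; abel)
    (fun c v w ↦ by simp only [sff, map_smul, christoffelOf_smul_right, smul_add, smul_sub])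

/-- Two sources: second derivatives commute, and both connections are torsion-free. -/
theorem sff_symm [FiniteDimensional ℝ E] [FiniteDimensional ℝ F]
    (hg : IsMetricAt g y) (hh : IsMetricAt h (ψ y)) (hψ : ContDiffAt ℝ 2 ψ y)
    (v w : E) : sff g h ψ y v w = sff g h ψ y w v := by
  have hs : IsSymmSndFDerivAt ℝ ψ y := hψ.isSymmSndFDerivAt (by simp)
  rw [sff, sff, hs v w, hg.christoffelOf_symm v w, hh.christoffelOf_symm]

theorem hasFDerivAt_fderiv (hψ : ContDiffAt ℝ 2 ψ y) :
    HasFDerivAt (fderiv ℝ ψ) (fderiv ℝ (fderiv ℝ ψ) y) y :=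
  ((hψ.fderiv_right (m := 1) (by norm_num)).differentiableAt one_ne_zero).hasFDerivAt

theorem sndFDeriv_comp (hψ : ContDiffAt ℝ 2 ψ y) (hχ : ContDiffAt ℝ 2 χ (ψ y)) (v w : E) :
    fderiv ℝ (fderiv ℝ (χ ∘ ψ)) y v w
      = fderiv ℝ (fderiv ℝ χ) (ψ y) (fderiv ℝ ψ y v) (fderiv ℝ ψ y w)
        + fderiv ℝ χ (ψ y) (fderiv ℝ (fderiv ℝ ψ) y v w) := by
  have hev : fderiv ℝ (χ ∘ ψ) =ᶠ[𝓝 y] fun z ↦ (fderiv ℝ χ (ψ z)).comp (fderiv ℝ ψ z) := by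
    have h1 := hψ.eventually (by simp)
    have h2 := hψ.continuousAt.eventually (hχ.eventually (by simp))
    filter_upwards [h1, h2] with z hz1 hz2
    exact fderiv_comp z (hz2.differentiableAt two_ne_zero) (hz1.differentiableAt two_ne_zero)
  have hd1 : HasFDerivAt (fun z ↦ fderiv ℝ χ (ψ z))
      ((fderiv ℝ (fderiv ℝ χ) (ψ y)).comp (fderiv ℝ ψ y)) y :=
    (hasFDerivAt_fderiv hχ).comp y (hψ.differentiableAt two_ne_zero).hasFDerivAt
  rw [hev.fderiv_eq, (hd1.clm_comp (hasFDerivAt_fderiv hψ)).fderiv]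
  simp [add_comm]

/-- The composition formula for second fundamental forms. -/
theorem sff_comp (hψ : ContDiffAt ℝ 2 ψ y) (hχ : ContDiffAt ℝ 2 χ (ψ y)) (v w : E) :
    sff g k (χ ∘ ψ) y v w
      = fderiv ℝ χ (ψ y) (sff g h ψ y v w)
        + sff h k χ (ψ y) (fderiv ℝ ψ y v) (fderiv ℝ ψ y w) := by
  have hD : fderiv ℝ (χ ∘ ψ) y = (fderiv ℝ χ (ψ y)).comp (fderiv ℝ ψ y) :=
    fderiv_comp y (hχ.differentiableAt two_ne_zero) (hψ.differentiableAt two_ne_zero)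
  simp only [sff, sndFDeriv_comp hψ hχ, hD, map_add, map_sub, ContinuousLinearMap.comp_apply,
    Function.comp_apply]
  abel

theorem sff_congr {ψ' : E → F} (hψ : ψ =ᶠ[𝓝 y] ψ') (v w : E) :
    sff g h ψ y v w = sff g h ψ' y v w := by
  rw [sff, sff, hψ.fderiv.fderiv_eq, hψ.fderiv_eq, hψ.eq_of_nhds]

/-- Derivative of the pull-back of a metric. -/
theorem fderiv_pullback (hh : IsMetricAt h (ψ y)) (hψ : ContDiffAt ℝ 2 ψ y)
    (v w z : E) :
    fderiv ℝ (fun y ↦ h (ψ y) (fderiv ℝ ψ y v) (fderiv ℝ ψ y w)) y z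
      = fderiv ℝ h (ψ y) (fderiv ℝ ψ y z) (fderiv ℝ ψ y v) (fderiv ℝ ψ y w)
        + h (ψ y) (fderiv ℝ (fderiv ℝ ψ) y z v) (fderiv ℝ ψ y w)
        + h (ψ y) (fderiv ℝ ψ y v) (fderiv ℝ (fderiv ℝ ψ) y z w) := by
  have hd := (hψ.differentiableAt two_ne_zero).hasFDerivAt
  have h0 : HasFDerivAt (fun y ↦ h (ψ y)) ((fderiv ℝ h (ψ y)).comp (fderiv ℝ ψ y)) y :=
    hh.differentiableAt.hasFDerivAt.comp y hd
  have hv := (hasFDerivAt_fderiv hψ).clm_apply (hasFDerivAt_const v y)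
  have hw := (hasFDerivAt_fderiv hψ).clm_apply (hasFDerivAt_const w y)
  rw [((h0.clm_apply hv).clm_apply hw).fderiv]
  simp
  ring

/-- A local isometry onto an open set is totally geodesic. -/
theorem sff_eq_zero_of_isometry [FiniteDimensional ℝ E] [FiniteDimensional ℝ F]
    (hg : IsMetricAt g y) (hh : IsMetricAt h (ψ y))
    (hψ : ContDiffAt ℝ 2 ψ y) (hsurj : Function.Surjective (fderiv ℝ ψ y))
    (hiso : ∀ᶠ y in 𝓝 y, ∀ v w, g y v w = h (ψ y) (fderiv ℝ ψ y v) (fderiv ℝ ψ y w))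
    (v w : E) : sff g h ψ y v w = 0 := by
  -- Differentiating the isometry equation and cancelling the Christoffel terms by metric
  -- compatibility shows that h(∇dψ(z, v), dψ w) is antisymmetric in v, w.
  have hanti : ∀ z v w, h (ψ y) (sff g h ψ y z v) (fderiv ℝ ψ y w)
      = - h (ψ y) (sff g h ψ y z w) (fderiv ℝ ψ y v) := by
    intro z v w
    have h1 := fderiv_pullback hh hψ v w z
    rw [← Filter.EventuallyEq.fderiv_eq (hiso.mono fun y hy ↦ hy v w)] at h1
    rw [(hg.hasFDerivAt_apply v w).fderiv] at h1
    simp only [ContinuousLinearMap.flip_apply] at h1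
    rw [hg.fderiv_apply, hh.fderiv_apply, hiso.self_of_nhds, hiso.self_of_nhds,
      hh.symm_self (fderiv ℝ ψ y v) _] at h1
    simp only [sff, map_add, map_sub, add_apply,
      sub_apply]
    linarith
  have hs := sff_symm hg hh hψ
  -- A trilinear form symmetric in its first two arguments and antisymmetric in its last two is
  -- zero.
  have hz : ∀ z v w, h (ψ y) (sff g h ψ y z v) (fderiv ℝ ψ y w) = 0 := by
    intro z v w
    have e1 := hanti z v w
    have e2 := hanti w z v
    have e3 := hanti v w z
    rw [hs w z] at e2
    rw [hs v w, hs v z] at e3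
    linarith
  refine eq_of_forall_apply_eq hh.pos_self fun a ↦ ?_
  obtain ⟨u, rfl⟩ := hsurj a
  rw [hz]
  simp

end Christoffel

end Coordinates

/-! ### Adjoints with respect to variable metrics -/

section Adjoint

variable {E F : Type*} [NormedAddCommGroup E] [NormedSpace ℝ E]
  [NormedAddCommGroup F] [NormedSpace ℝ F]

/-- The adjoint of `A` with respect to the bilinear forms `g` and `h`. -/
noncomputable def formAdjoint (g : E →L[ℝ] E →L[ℝ] ℝ) (h : F →L[ℝ] F →L[ℝ] ℝ) (A : E →L[ℝ] F) :
    F →L[ℝ] E :=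
  g.inverse ∘L ((ContinuousLinearMap.compL ℝ E F ℝ).flip A) ∘L h

theorem apply_formAdjoint {g : E →L[ℝ] E →L[ℝ] ℝ} (hg : g.IsInvertible)
    (h : F →L[ℝ] F →L[ℝ] ℝ) (A : E →L[ℝ] F) (ξ : F) (v : E) :
    g (formAdjoint g h A ξ) v = h ξ (A v) := by
  simp [formAdjoint, apply_inverse_of_isInvertible hg]

variable [FiniteDimensional ℝ E]
  {g : E → E →L[ℝ] E →L[ℝ] ℝ} {h : F → F →L[ℝ] F →L[ℝ] ℝ} {ψ : E → F} {y : E}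

theorem contDiffAt_formAdjoint (hg : IsMetricAt g y) (hh : IsMetricAt h (ψ y))
    (hψ : ContDiffAt ℝ 2 ψ y) :
    ContDiffAt ℝ 1 (fun z ↦ formAdjoint (g z) (h (ψ z)) (fderiv ℝ ψ z)) y := by
  have hi : ContDiffAt ℝ 1 (fun z ↦ (g z).inverse) y :=
    hg.isInvertible.contDiffAt_map_inverse.comp y hg.contDiffAt
  have hA : ContDiffAt ℝ 1 (fun z ↦ (ContinuousLinearMap.compL ℝ E F ℝ).flip (fderiv ℝ ψ z)) y :=
    contDiffAt_const.clm_apply (hψ.fderiv_right (m := 1) (by norm_num))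
  have hhψ : ContDiffAt ℝ 1 (fun z ↦ h (ψ z)) y :=
    hh.contDiffAt.comp y (hψ.of_le (by norm_num))
  exact hi.clm_comp (hA.clm_comp hhψ)

end Adjoint

/-! ### Differentiating vertical fields -/

section Vertical

variable {E F : Type*} [NormedAddCommGroup E] [NormedSpace ℝ E]
  [NormedAddCommGroup F] [NormedSpace ℝ F]
  {g : E → E →L[ℝ] E →L[ℝ] ℝ} {h : F → F →L[ℝ] F →L[ℝ] ℝ} {ψ : E → F} {y : E}

/-- The covariant derivative of a vertical vector field, up to vertical vectors. -/
theorem fderiv_covariant_of_vertical (hψ : ContDiffAt ℝ 2 ψ y) {W : E → E}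
    (hW : DifferentiableAt ℝ W y) (hker : ∀ᶠ z in 𝓝 y, fderiv ℝ ψ z (W z) = 0) (v : E) :
    fderiv ℝ ψ y (fderiv ℝ W y v + christoffelOf g y v (W y)) = - sff g h ψ y v (W y) := by
  have h1 := (hasFDerivAt_fderiv hψ).clm_apply hW.hasFDerivAt
  have h2 : HasFDerivAt (fun z ↦ fderiv ℝ ψ z (W z)) (0 : E →L[ℝ] F) y :=
    (hasFDerivAt_const (0 : F) y).congr_of_eventuallyEq hker
  have h3 := DFunLike.congr_fun (h1.unique h2) v
  simp at h3
  have h4 : christoffelOf h (ψ y) (fderiv ℝ ψ y v) 0 = 0 := by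
    simpa using christoffelOf_smul_right h (ψ y) 0 (fderiv ℝ ψ y v) 0
  rw [sff, hker.self_of_nhds, h4, map_add, eq_neg_of_add_eq_zero_left h3]
  abel

end Vertical

/-! ### Horizontally conformal submersions in coordinates -/

section Conformal

variable {E F : Type*} [NormedAddCommGroup E] [NormedSpace ℝ E] [FiniteDimensional ℝ E]
  [NormedAddCommGroup F] [NormedSpace ℝ F] [FiniteDimensional ℝ F]
  {g : E → E →L[ℝ] E →L[ℝ] ℝ} {h : F → F →L[ℝ] F →L[ℝ] ℝ} {ψ : E → F} {μ : E → ℝ} {y : E}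

/-- `ψ` is a horizontally conformal submersion near `y`, with squared dilation `μ`. -/
structure IsConformalAt (g : E → E →L[ℝ] E →L[ℝ] ℝ) (h : F → F →L[ℝ] F →L[ℝ] ℝ) (ψ : E → F)
    (μ : E → ℝ) (y : E) : Prop where
  domain : IsMetricAt g y
  target : IsMetricAt h (ψ y)
  contDiffAt : ContDiffAt ℝ 2 ψ y
  pos : ∀ᶠ z in 𝓝 y, 0 < μ z
  apply_adjoint : ∀ᶠ z in 𝓝 y, ∀ ξ,
    fderiv ℝ ψ z (formAdjoint (g z) (h (ψ z)) (fderiv ℝ ψ z) ξ) = μ z • ξ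

namespace IsConformalAt

omit [FiniteDimensional ℝ F] in
-- No regularity of the dilation is assumed. For a fixed ξ ≠ 0, the equation A A* ξ = μ ξ exhibits μ
-- as the quotient h(A A* ξ, ξ) / h(ξ, ξ) of differentiable functions.
theorem differentiableAt_dilation [Nontrivial F] (H : IsConformalAt g h ψ μ y) :
    DifferentiableAt ℝ μ y := by
  obtain ⟨ξ, hξ⟩ := exists_ne (0 : F)
  have hhψ : DifferentiableAt ℝ (fun z ↦ h (ψ z)) y :=
    H.target.differentiableAt.comp y (H.contDiffAt.differentiableAt two_ne_zero)
  have hC := (contDiffAt_formAdjoint H.domain H.target H.contDiffAt).differentiableAt one_ne_zero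
  have hA := (hasFDerivAt_fderiv H.contDiffAt).differentiableAt
  have hpos : ∀ᶠ z in 𝓝 y, ∀ v, v ≠ 0 → 0 < h (ψ z) v v :=
    H.contDiffAt.continuousAt.eventually H.target.pos
  have hev : μ =ᶠ[𝓝 y] fun z ↦
      h (ψ z) (fderiv ℝ ψ z (formAdjoint (g z) (h (ψ z)) (fderiv ℝ ψ z) ξ)) ξ / h (ψ z) ξ ξ := by
    filter_upwards [H.apply_adjoint, hpos] with z hz hz'
    have := (hz' ξ hξ).ne'
    rw [hz]
    simp [this]
  refine DifferentiableAt.congr_of_eventuallyEq ?_ hev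
  simp only [div_eq_mul_inv]
  refine DifferentiableAt.fun_mul ?_ (DifferentiableAt.fun_inv ?_ (H.target.pos_self ξ hξ).ne')
  · exact (hhψ.clm_apply (hA.clm_apply (hC.clm_apply (differentiableAt_const ξ)))).clm_apply
      (differentiableAt_const ξ)
  · exact (hhψ.clm_apply (differentiableAt_const ξ)).clm_apply (differentiableAt_const ξ)

/-- Invariantly, this is the derivative of A A* = μ id, namely (∇_z A) A* + A (∇_z A)* = dμ(z) id.
In coordinates, g(Cξ, Cη) = μ h(ξ, η) is differentiated, where C = A*, and the derivative of C is
eliminated by differentiating A C ξ = μ ξ. -/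
theorem sff_adjoint_add [Nontrivial F] (H : IsConformalAt g h ψ μ y) (z : E) (ξ η : F) :
    h (ψ y) (sff g h ψ y z (formAdjoint (g y) (h (ψ y)) (fderiv ℝ ψ y) ξ)) η
      + h (ψ y) (sff g h ψ y z (formAdjoint (g y) (h (ψ y)) (fderiv ℝ ψ y) η)) ξ
      = fderiv ℝ μ y z * h (ψ y) ξ η := by
  set C := fun z ↦ formAdjoint (g z) (h (ψ z)) (fderiv ℝ ψ z) with hCdef
  have hμ := H.differentiableAt_dilation.hasFDerivAt
  have hC : HasFDerivAt C (fderiv ℝ C y) y :=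
    ((contDiffAt_formAdjoint H.domain H.target H.contDiffAt).differentiableAt
      one_ne_zero).hasFDerivAt
  have hA := hasFDerivAt_fderiv H.contDiffAt
  have hhψ : HasFDerivAt (fun z ↦ h (ψ z)) ((fderiv ℝ h (ψ y)).comp (fderiv ℝ ψ y)) y :=
    HasFDerivAt.comp (g := h) y H.target.differentiableAt.hasFDerivAt
      (H.contDiffAt.differentiableAt two_ne_zero).hasFDerivAt
  have hsymm := H.target.symm_self
  have hCξ : ∀ ξ, HasFDerivAt (fun z ↦ C z ξ) ((fderiv ℝ C y).flip ξ) y := fun ξ ↦ by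
    convert! hC.clm_apply (hasFDerivAt_const ξ y) using 1
    ext; simp
  have hadj : ∀ ξ v, g y (C y ξ) v = h (ψ y) ξ (fderiv ℝ ψ y v) := fun ξ v ↦
    apply_formAdjoint H.domain.isInvertible _ _ ξ v
  have e1 : ∀ ξ, fderiv ℝ ψ y (fderiv ℝ C y z ξ)
      = fderiv ℝ μ y z • ξ - fderiv ℝ (fderiv ℝ ψ) y z (C y ξ) := by
    intro ξ
    have h1 := hA.clm_apply (hCξ ξ)
    have h2 := (hμ.smul_const ξ).congr_of_eventuallyEq (H.apply_adjoint.mono fun z hz ↦ hz ξ)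
    have h3 := DFunLike.congr_fun (h1.unique h2) z
    simp at h3
    rw [← h3]
    abel
  have hginv : ∀ᶠ z in 𝓝 y, (g z).IsInvertible := H.domain.pos.mono fun z hz ↦
    isInvertible_of_pos hz
  have hev : (fun z ↦ g z (C z ξ) (C z η)) =ᶠ[𝓝 y] fun z ↦ μ z * h (ψ z) ξ η := by
    filter_upwards [H.apply_adjoint, hginv] with z hz hz'
    rw [apply_formAdjoint hz', hz]
    simp
  have d1 := (H.domain.differentiableAt.hasFDerivAt.clm_apply (hCξ ξ)).clm_apply (hCξ η)
  have d2 := (hμ.mul ((hhψ.clm_apply (hasFDerivAt_const ξ y)).clm_apply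
    (hasFDerivAt_const η y))).congr_of_eventuallyEq hev
  have d3 := DFunLike.congr_fun (d1.unique d2) z
  simp only [add_apply, ContinuousLinearMap.flip_apply,
    ContinuousLinearMap.comp_apply, smul_apply,
    zero_apply, map_zero, zero_add, smul_eq_mul] at d3
  rw [H.domain.symm_self (fderiv ℝ C y z ξ), hadj, hadj, e1, e1, H.domain.fderiv_apply,
    H.domain.symm_self _ (C y η), H.domain.symm_self _ (C y ξ), hadj, hadj,
    H.target.fderiv_apply] at d3
  simp only [sff, H.apply_adjoint.self_of_nhds, christoffelOf_smul_right, map_add, map_sub,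
    map_smul, add_apply, sub_apply, smul_apply, smul_eq_mul] at d3 ⊢
  rw [hsymm η, hsymm ξ (fderiv ℝ (fderiv ℝ ψ) y z (C y η)),
    hsymm η, hsymm ξ (fderiv ℝ ψ y (christoffelOf g y z (C y η))), hsymm η] at d3
  simp only [hCdef] at d3
  linarith

/-- The trace of the second fundamental form over the horizontal space. -/
theorem sum_sff_adjoint [Nontrivial F] (H : IsConformalAt g h ψ μ y) {ι : Type*} [Fintype ι]
    {ξ : ι → F} (hone : ∀ i, h (ψ y) (ξ i) (ξ i) = 1)
    (hsum : ∀ η, ∑ i, h (ψ y) (ξ i) η • ξ i = η) (η : F) :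
    h (ψ y) (∑ i, sff g h ψ y (formAdjoint (g y) (h (ψ y)) (fderiv ℝ ψ y) (ξ i))
        (formAdjoint (g y) (h (ψ y)) (fderiv ℝ ψ y) (ξ i))) η
      = (1 - (Fintype.card ι : ℝ) / 2)
        * fderiv ℝ μ y (formAdjoint (g y) (h (ψ y)) (fderiv ℝ ψ y) η) := by
  set C := formAdjoint (g y) (h (ψ y)) (fderiv ℝ ψ y) with hC
  -- Apply `sff_adjoint_add` to the pair (ξ i, η) in direction C (ξ i). By symmetry the unwanted
  -- term is h(∇dψ(Cη, C ξ_i), ξ_i), and the case of equal vectors shows that it is dμ(Cη) / 2.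
  have e1 : ∀ i, h (ψ y) (sff g h ψ y (C (ξ i)) (C (ξ i))) η
      = h (ψ y) (ξ i) η * fderiv ℝ μ y (C (ξ i)) - fderiv ℝ μ y (C η) / 2 := by
    intro i
    have a1 := H.sff_adjoint_add (C (ξ i)) (ξ i) η
    have a2 := H.sff_adjoint_add (C η) (ξ i) (ξ i)
    rw [hone] at a2
    rw [← hC] at a1 a2
    rw [sff_symm H.domain H.target H.contDiffAt (C (ξ i)) (C η)] at a1
    linarith
  have e2 : fderiv ℝ μ y (C η) = ∑ i, h (ψ y) (ξ i) η * fderiv ℝ μ y (C (ξ i)) := by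
    conv_lhs => rw [← hsum η]
    simp
  rw [map_sum, sum_apply]
  simp only [e1, Finset.sum_sub_distrib, ← e2]
  simp
  ring

end IsConformalAt

end Conformal

/-! ### Conformal surjections and traces on inner product spaces -/

section LinearAlgebra

variable {T T' : Type*} [NormedAddCommGroup T] [InnerProductSpace ℝ T] [FiniteDimensional ℝ T]
  [NormedAddCommGroup T'] [InnerProductSpace ℝ T'] [FiniteDimensional ℝ T']

theorem adjoint_mem_ker_orthogonal (A : T →L[ℝ] T') (ξ : T') :
    A.adjoint ξ ∈ (LinearMap.ker A.toLinearMap)ᗮ := by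
  intro v hv
  rw [ContinuousLinearMap.adjoint_inner_right]
  have : A v = 0 := hv
  simp [this]

/-- A* takes horizontal values, and by surjectivity it suffices to test against A w with w
horizontal. The resulting equation A A* = c² id does not mention the horizontal space, so it can be
differentiated as the point varies. -/
theorem apply_adjoint_of_conformal {A : T →L[ℝ] T'} {c : ℝ}
    (hsurj : SurjOn A ((LinearMap.ker A.toLinearMap)ᗮ : Submodule ℝ T) univ)
    (hc : ∀ v ∈ (LinearMap.ker A.toLinearMap)ᗮ, ∀ w ∈ (LinearMap.ker A.toLinearMap)ᗮ,
      inner ℝ (A v) (A w) = c ^ 2 * inner ℝ v w) (ξ : T') :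
    A (A.adjoint ξ) = c ^ 2 • ξ := by
  refine ext_inner_right ℝ fun η ↦ ?_
  obtain ⟨w, hw, rfl⟩ := hsurj (mem_univ η)
  rw [hc _ (adjoint_mem_ker_orthogonal A ξ) _ hw, ContinuousLinearMap.adjoint_inner_left,
    real_inner_smul_left]

/-- This formula makes the vertical projection visibly differentiable in the base point. -/
theorem starProjection_ker_of_conformal {A : T →L[ℝ] T'}
    {c : ℝ} (hc : c ≠ 0) (hA : ∀ ξ, A (A.adjoint ξ) = c ^ 2 • ξ) (v : T) :
    (LinearMap.ker A.toLinearMap).starProjection v = v - (c ^ 2)⁻¹ • A.adjoint (A v) := by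
  refine (Submodule.eq_starProjection_of_mem_orthogonal' (K := LinearMap.ker A.toLinearMap)
    (z := (c ^ 2)⁻¹ • A.adjoint (A v)) ?_ ?_ ?_)
  · simp [hA, hc]
  · exact Submodule.smul_mem _ _ (adjoint_mem_ker_orthogonal A _)
  · simp

/-- Both sums are the contraction of B with the canonical covariant tensor, which does not depend on
a basis. -/
theorem sum_orthonormalBasis_eq {ι κ G : Type*} [Fintype ι] [Fintype κ] [AddCommGroup G]
    [Module ℝ G] (b : OrthonormalBasis ι ℝ T) (b' : OrthonormalBasis κ ℝ T)
    (B : T →ₗ[ℝ] T →ₗ[ℝ] G) : ∑ i, B (b i) (b i) = ∑ i, B (b' i) (b' i) := by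
  have h := (InnerProductSpace.canonicalCovariantTensor_eq_sum T b).symm.trans
    (InnerProductSpace.canonicalCovariantTensor_eq_sum T b')
  simpa using congrArg (TensorProduct.lift B) h

omit [FiniteDimensional ℝ T] in
-- Orthonormal bases chosen separately at each point need not vary continuously. A coordinate basis
-- and its metric dual do, so this form of the trace is the one used for continuity.
theorem sum_orthonormalBasis_eq_sum_dual {ι κ G : Type*} [Fintype ι] [Fintype κ] [AddCommGroup G]
    [Module ℝ G] (b : OrthonormalBasis ι ℝ T) (e : Module.Basis κ ℝ T) {d : κ → T}
    (hd : ∀ k v, inner ℝ (d k) v = e.repr v k)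
    (B : T →ₗ[ℝ] T →ₗ[ℝ] G) : ∑ i, B (b i) (b i) = ∑ k, B (d k) (e k) := by
  have h1 : ∀ i, B (b i) (b i) = ∑ k, e.repr (b i) k • B (b i) (e k) := fun i ↦ by
    conv_lhs => enter [2]; rw [← e.sum_repr (b i)]
    simp only [map_sum, map_smul]
  have h2 : ∀ k, B (d k) (e k) = ∑ i, e.repr (b i) k • B (b i) (e k) := fun k ↦ by
    conv_lhs => rw [← b.sum_repr' (d k)]
    simp [← hd, real_inner_comm]
  simp only [h1, h2]
  exact Finset.sum_comm

/-- Splitting of a trace along the kernel of a conformal surjection. -/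
theorem sum_orthonormalBasis_eq_add_of_conformal
    {ι κ ν G : Type*} [Fintype ι] [Fintype κ] [Fintype ν] [AddCommGroup G] [Module ℝ G]
    {A : T →L[ℝ] T'} {c : ℝ} (hc : c ≠ 0) (hA : ∀ ξ, A (A.adjoint ξ) = c ^ 2 • ξ)
    (b : OrthonormalBasis ι ℝ T) (v : OrthonormalBasis κ ℝ (LinearMap.ker A.toLinearMap))
    (ξ : OrthonormalBasis ν ℝ T') (B : T →ₗ[ℝ] T →ₗ[ℝ] G) :
    ∑ i, B (b i) (b i) = ∑ i, B (v i) (v i)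
      + (c ^ 2)⁻¹ • ∑ j, B (A.adjoint (ξ j)) (A.adjoint (ξ j)) := by
  classical
  -- Since ⟨A* ξ, A* η⟩ = c² ⟨ξ, η⟩, the vectors c⁻¹ A* ξ_j are orthonormal; with the vertical basis
  -- they form an orthonormal basis of T.
  let X : κ ⊕ ν → T := Sum.elim (fun i ↦ (v i : T)) (fun j ↦ c⁻¹ • A.adjoint (ξ j))
  have hX : Orthonormal ℝ X := by
    rw [orthonormal_iff_ite]
    have hv := orthonormal_iff_ite.1 v.orthonormal
    have hξ := orthonormal_iff_ite.1 ξ.orthonormal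
    have hz : ∀ i j, inner ℝ (v i : T) (A.adjoint (ξ j)) = 0 := fun i j ↦
      adjoint_mem_ker_orthogonal A (ξ j) _ (v i).2
    rintro (i | i) (j | j)
    · simpa [X] using hv i j
    · simp [X, real_inner_smul_right, hz]
    · rw [real_inner_comm]
      simp [X, real_inner_smul_right, hz]
    · simp only [X, Sum.elim_inr, real_inner_smul_left, real_inner_smul_right,
        ContinuousLinearMap.adjoint_inner_left, hA, hξ, Sum.inr.injEq]
      split_ifs <;> field_simp
  have hspan : ⊤ ≤ Submodule.span ℝ (Set.range X) := by
    intro z _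
    have hz : z = (LinearMap.ker A.toLinearMap).starProjection z
        + (c ^ 2)⁻¹ • A.adjoint (A z) := by
      rw [starProjection_ker_of_conformal hc hA]; abel
    rw [hz]
    refine Submodule.add_mem _ ?_ (Submodule.smul_mem _ _ ?_)
    · rw [Submodule.starProjection_apply]
      rw [← v.sum_repr (Submodule.orthogonalProjectionOnto _ z)]
      rw [Submodule.coe_sum]
      refine Submodule.sum_mem _ fun i _ ↦ Submodule.smul_mem _ _ ?_
      exact Submodule.subset_span ⟨Sum.inl i, rfl⟩
    · rw [← ξ.sum_repr (A z), map_sum]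
      refine Submodule.sum_mem _ fun j _ ↦ ?_
      rw [map_smul]
      refine Submodule.smul_mem _ _ ?_
      have : A.adjoint (ξ j) = c • X (Sum.inr j) := by simp [X, hc]
      rw [this]
      exact Submodule.smul_mem _ _ (Submodule.subset_span ⟨_, rfl⟩)
  rw [sum_orthonormalBasis_eq b (OrthonormalBasis.mk hX hspan) B]
  simp [X, Finset.smul_sum, smul_smul, pow_two]

end LinearAlgebra

/-! ### Charts, their differentials, and the metric in a chart -/

section Neighborhoods

variable {E : Type*} [NormedAddCommGroup E] [NormedSpace ℝ E]
  {M : Type*} [TopologicalSpace M] [ChartedSpace E M]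

theorem eventually_nhds_extChartAt {p q : M} (hq : q ∈ (extChartAt 𝓘(ℝ, E) p).source)
    {P : E → Prop}
    (h : ∀ᶠ z in 𝓝 q, z ∈ (extChartAt 𝓘(ℝ, E) p).source → P (extChartAt 𝓘(ℝ, E) p z)) :
    ∀ᶠ y in 𝓝 (extChartAt 𝓘(ℝ, E) p q), P y := by
  have hy := (extChartAt 𝓘(ℝ, E) p).map_source hq
  have h1 := continuousAt_extChartAt_symm'' (I := 𝓘(ℝ, E)) hy
  rw [ContinuousAt, (extChartAt 𝓘(ℝ, E) p).left_inv hq] at h1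
  filter_upwards [(isOpen_extChartAt_target (I := 𝓘(ℝ, E)) p).mem_nhds hy, h1.eventually h]
    with y hy hP
  have := hP ((extChartAt 𝓘(ℝ, E) p).map_target hy)
  rwa [(extChartAt 𝓘(ℝ, E) p).right_inv hy] at this

end Neighborhoods

section ChartDeriv

variable {E : Type*} [NormedAddCommGroup E] [NormedSpace ℝ E]
  {M : Type*} [TopologicalSpace M] [ChartedSpace E M]

variable (E) in
/-- The differential at `q` of the chart at `p`. -/
noncomputable def chartDeriv (p q : M) : TangentSpace 𝓘(ℝ, E) q →L[ℝ] E :=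
  mfderiv 𝓘(ℝ, E) 𝓘(ℝ, E) (extChartAt 𝓘(ℝ, E) p) q

variable [IsManifold 𝓘(ℝ, E) ∞ M]

theorem chartDeriv_self (p : M) (v : TangentSpace 𝓘(ℝ, E) p) : chartDeriv E p p v = v := by
  exact DFunLike.congr_fun (mfderiv_extChartAt_self (I := 𝓘(ℝ, E)) (x := p)) v

theorem exists_chartDeriv_eq {p q : M} (hq : q ∈ (extChartAt 𝓘(ℝ, E) p).source) (v : E) :
    ∃ w : TangentSpace 𝓘(ℝ, E) q, chartDeriv E p q w = v := by
  obtain ⟨A, hA⟩ := isInvertible_mfderiv_extChartAt (I := 𝓘(ℝ, E)) hq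
  refine ⟨A.symm v, ?_⟩
  rw [chartDeriv, ← hA]
  exact A.apply_symm_apply v

theorem chartDeriv_injective {p q : M} (hq : q ∈ (extChartAt 𝓘(ℝ, E) p).source) :
    Function.Injective (chartDeriv E p q) := by
  obtain ⟨A, hA⟩ := isInvertible_mfderiv_extChartAt (I := 𝓘(ℝ, E)) hq
  rw [chartDeriv, ← hA]
  exact A.injective

theorem mfderiv_extChartAt_symm_chartDeriv {p : M} {y : E}
    (hy : y ∈ (extChartAt 𝓘(ℝ, E) p).target)
    (v : TangentSpace 𝓘(ℝ, E) ((extChartAt 𝓘(ℝ, E) p).symm y)) :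
    mfderiv 𝓘(ℝ, E) 𝓘(ℝ, E) (extChartAt 𝓘(ℝ, E) p).symm y
      (chartDeriv E p ((extChartAt 𝓘(ℝ, E) p).symm y) v) = v := by
  have h := mfderivWithin_extChartAt_symm_comp_mfderiv_extChartAt (I := 𝓘(ℝ, E)) hy
  rw [modelWithCornersSelf_coe, range_id, mfderivWithin_univ] at h
  exact DFunLike.congr_fun h v

theorem mfderiv_extChartAt_symm_injective {p : M} {y : E}
    (hy : y ∈ (extChartAt 𝓘(ℝ, E) p).target) :
    Function.Injective (mfderiv 𝓘(ℝ, E) 𝓘(ℝ, E) (extChartAt 𝓘(ℝ, E) p).symm y) := by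
  obtain ⟨A, hA⟩ := isInvertible_mfderivWithin_extChartAt_symm (I := 𝓘(ℝ, E)) hy
  rw [modelWithCornersSelf_coe, range_id, mfderivWithin_univ] at hA
  rw [← hA]
  exact A.injective

/-- A coordinate field is the tangent map of the inverse chart applied to a constant field. The
coefficients of the metric in the chart are inner products of such fields. -/
theorem contMDiffOn_coordinateField (p : M) (v : E) :
    ContMDiffOn 𝓘(ℝ, E) 𝓘(ℝ, E).tangent 1
      (fun y ↦ (TotalSpace.mk' E ((extChartAt 𝓘(ℝ, E) p).symm y)
        (mfderiv 𝓘(ℝ, E) 𝓘(ℝ, E) (extChartAt 𝓘(ℝ, E) p).symm y v) : TangentBundle 𝓘(ℝ, E) M))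
      (extChartAt 𝓘(ℝ, E) p).target := by
  have hopen := isOpen_extChartAt_target (I := 𝓘(ℝ, E)) p
  have h1 : ContMDiffOn 𝓘(ℝ, E) 𝓘(ℝ, E) 2 (extChartAt 𝓘(ℝ, E) p).symm
      (extChartAt 𝓘(ℝ, E) p).target :=
    contMDiffOn_extChartAt_symm p
  have h2 := h1.contMDiffOn_tangentMapWithin (m := 1) (by norm_num) hopen.uniqueMDiffOn
  have h3 : ContMDiff 𝓘(ℝ, E) 𝓘(ℝ, E).tangent 1
      (fun y : E ↦ (TotalSpace.mk' E y v : TangentBundle 𝓘(ℝ, E) E)) :=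
    contMDiff_vectorSpace_iff_contDiff.2 contDiff_const
  refine (h2.comp h3.contMDiffOn (s := (extChartAt 𝓘(ℝ, E) p).target) fun y hy ↦ hy).congr ?_
  intro y hy
  simp only [Function.comp_apply, tangentMapWithin]
  rw [mfderivWithin_of_isOpen hopen hy]

end ChartDeriv

section ChartMetric

variable {E : Type*} [NormedAddCommGroup E] [NormedSpace ℝ E]
  {M : Type*} [TopologicalSpace M] [ChartedSpace E M]
  [RiemannianBundle (fun x : M ↦ TangentSpace 𝓘(ℝ, E) x)]

theorem chartMetric_apply (p : M) (y v w : E) :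
    chartMetric p y v w
      = inner ℝ (mfderiv 𝓘(ℝ, E) 𝓘(ℝ, E) (extChartAt 𝓘(ℝ, E) p).symm y v)
        (mfderiv 𝓘(ℝ, E) 𝓘(ℝ, E) (extChartAt 𝓘(ℝ, E) p).symm y w) := rfl

variable [IsManifold 𝓘(ℝ, E) ∞ M]

theorem chartMetric_chartDeriv {p q : M} (hq : q ∈ (extChartAt 𝓘(ℝ, E) p).source)
    (v w : TangentSpace 𝓘(ℝ, E) q) :
    chartMetric p (extChartAt 𝓘(ℝ, E) p q) (chartDeriv E p q v) (chartDeriv E p q w)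
      = inner ℝ v w := by
  obtain ⟨y, hy, rfl⟩ : ∃ y ∈ (extChartAt 𝓘(ℝ, E) p).target, (extChartAt 𝓘(ℝ, E) p).symm y = q :=
    ⟨_, (extChartAt 𝓘(ℝ, E) p).map_source hq, (extChartAt 𝓘(ℝ, E) p).left_inv hq⟩
  rw [(extChartAt 𝓘(ℝ, E) p).right_inv hy, chartMetric_apply,
    mfderiv_extChartAt_symm_chartDeriv hy, mfderiv_extChartAt_symm_chartDeriv hy]

theorem chartMetric_self (p : M) (v w : TangentSpace 𝓘(ℝ, E) p) :
    chartMetric p (extChartAt 𝓘(ℝ, E) p p) v w = inner ℝ v w := by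
  have h := chartMetric_chartDeriv (mem_extChartAt_source (I := 𝓘(ℝ, E)) p) v w
  rwa [chartDeriv_self, chartDeriv_self] at h

variable [FiniteDimensional ℝ E]
  [IsContMDiffRiemannianBundle 𝓘(ℝ, E) ∞ E (fun x : M ↦ TangentSpace 𝓘(ℝ, E) x)]

theorem contDiffOn_chartMetric (p : M) :
    ContDiffOn ℝ 1 (chartMetric p) (extChartAt 𝓘(ℝ, E) p).target := by
  rw [contDiffOn_clm_apply]
  intro v
  rw [contDiffOn_clm_apply]
  intro w
  rw [← contMDiffOn_iff_contDiffOn]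
  exact ContMDiffOn.inner_bundle (IB := 𝓘(ℝ, E)) (F := E)
    (E := fun x : M ↦ TangentSpace 𝓘(ℝ, E) x) (contMDiffOn_coordinateField p v)
    (contMDiffOn_coordinateField p w)

theorem isMetricAt_chartMetric (p : M) {y : E} (hy : y ∈ (extChartAt 𝓘(ℝ, E) p).target) :
    IsMetricAt (chartMetric p) y := by
  have hmem := (isOpen_extChartAt_target (I := 𝓘(ℝ, E)) p).mem_nhds hy
  refine ⟨(contDiffOn_chartMetric p).contDiffAt hmem, ?_, ?_⟩
  · exact Filter.Eventually.of_forall fun z v w ↦ by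
      rw [chartMetric_apply, chartMetric_apply, real_inner_comm]
  · filter_upwards [hmem] with z hz v hv
    rw [chartMetric_apply]
    refine real_inner_self_pos.2 fun h ↦ hv ?_
    exact mfderiv_extChartAt_symm_injective hz (h.trans (map_zero _).symm)

theorem isMetricAt_chartMetric_of_mem_source {p q : M} (hq : q ∈ (extChartAt 𝓘(ℝ, E) p).source) :
    IsMetricAt (chartMetric p) (extChartAt 𝓘(ℝ, E) p q) :=
  isMetricAt_chartMetric p ((extChartAt 𝓘(ℝ, E) p).map_source hq)

end ChartMetric

/-! ### Maps in charts -/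

section CoordinateMap

variable {E : Type*} [NormedAddCommGroup E] [NormedSpace ℝ E]
  {M : Type*} [TopologicalSpace M] [ChartedSpace E M]
  {F : Type*} [NormedAddCommGroup F] [NormedSpace ℝ F]
  {N : Type*} [TopologicalSpace N] [ChartedSpace F N]
  {G : Type*} [NormedAddCommGroup G] [NormedSpace ℝ G]

variable (E F) in
/-- The map `φ` in the charts at `p` and `p'`. -/
noncomputable def coordMap (φ : M → N) (p : M) (p' : N) : E → F :=
  extChartAt 𝓘(ℝ, F) p' ∘ φ ∘ (extChartAt 𝓘(ℝ, E) p).symm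

theorem coordMap_extChartAt (φ : M → N) {p q : M} (p' : N)
    (hq : q ∈ (extChartAt 𝓘(ℝ, E) p).source) :
    coordMap E F φ p p' (extChartAt 𝓘(ℝ, E) p q) = extChartAt 𝓘(ℝ, F) p' (φ q) := by
  simp only [coordMap, Function.comp_apply, (extChartAt 𝓘(ℝ, E) p).left_inv hq]

variable [IsManifold 𝓘(ℝ, F) ∞ N]

theorem contMDiffAt_extChartAt_comp {φ : M → N} {q : M} {p' : N} {n : ℕ∞}
    (hq' : φ q ∈ (extChartAt 𝓘(ℝ, F) p').source) (hφ : ContMDiffAt 𝓘(ℝ, E) 𝓘(ℝ, F) n φ q) :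
    ContMDiffAt 𝓘(ℝ, E) 𝓘(ℝ, F) n (extChartAt 𝓘(ℝ, F) p' ∘ φ) q :=
  ContMDiffAt.comp q ((contMDiffAt_extChartAt' (n := ∞)
    (by rwa [← extChartAt_source (I := 𝓘(ℝ, F))])).of_le (by exact_mod_cast le_top)) hφ

variable [IsManifold 𝓘(ℝ, E) ∞ M]

theorem contDiffAt_comp_symm {n : ℕ∞} {u : M → G} {p q : M}
    (hq : q ∈ (extChartAt 𝓘(ℝ, E) p).source)
    (hu : ContMDiffAt 𝓘(ℝ, E) 𝓘(ℝ, G) n u q) :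
    ContDiffAt ℝ n (u ∘ (extChartAt 𝓘(ℝ, E) p).symm) (extChartAt 𝓘(ℝ, E) p q) := by
  rw [← contMDiffAt_iff_contDiffAt]
  have hs : ContMDiffAt 𝓘(ℝ, E) 𝓘(ℝ, E) n (extChartAt 𝓘(ℝ, E) p).symm
      (extChartAt 𝓘(ℝ, E) p q) :=
    ((contMDiffOn_extChartAt_symm (n := ∞) p).contMDiffAt
      ((isOpen_extChartAt_target (I := 𝓘(ℝ, E)) p).mem_nhds
        ((extChartAt 𝓘(ℝ, E) p).map_source hq))).of_le (by exact_mod_cast le_top)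
  exact ContMDiffAt.comp_of_eq hu hs ((extChartAt 𝓘(ℝ, E) p).left_inv hq)

theorem fderiv_comp_symm_chartDeriv {u : M → G} {p q : M}
    (hq : q ∈ (extChartAt 𝓘(ℝ, E) p).source)
    (hu : DifferentiableAt ℝ (u ∘ (extChartAt 𝓘(ℝ, E) p).symm) (extChartAt 𝓘(ℝ, E) p q))
    (v : TangentSpace 𝓘(ℝ, E) q) :
    fderiv ℝ (u ∘ (extChartAt 𝓘(ℝ, E) p).symm) (extChartAt 𝓘(ℝ, E) p q) (chartDeriv E p q v)
      = mfderiv 𝓘(ℝ, E) 𝓘(ℝ, G) u q v := by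
  have hd : MDifferentiableAt 𝓘(ℝ, E) 𝓘(ℝ, G) (u ∘ (extChartAt 𝓘(ℝ, E) p).symm)
      (extChartAt 𝓘(ℝ, E) p q) :=
    hu.mdifferentiableAt
  have hc : MDifferentiableAt 𝓘(ℝ, E) 𝓘(ℝ, E) (extChartAt 𝓘(ℝ, E) p) q :=
    mdifferentiableAt_extChartAt (by rwa [← extChartAt_source (I := 𝓘(ℝ, E))])
  have hev : u =ᶠ[𝓝 q] (u ∘ (extChartAt 𝓘(ℝ, E) p).symm) ∘ extChartAt 𝓘(ℝ, E) p := by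
    filter_upwards [extChartAt_source_mem_nhds' hq] with z hz
    simp only [Function.comp_apply, (extChartAt 𝓘(ℝ, E) p).left_inv hz]
  rw [hev.mfderiv_eq, mfderiv_comp q hd hc, mfderiv_eq_fderiv]
  rfl

theorem contDiffAt_coordMap {n : ℕ∞} {φ : M → N} {p q : M} {p' : N}
    (hq : q ∈ (extChartAt 𝓘(ℝ, E) p).source) (hq' : φ q ∈ (extChartAt 𝓘(ℝ, F) p').source)
    (hφ : ContMDiffAt 𝓘(ℝ, E) 𝓘(ℝ, F) n φ q) :
    ContDiffAt ℝ n (coordMap E F φ p p') (extChartAt 𝓘(ℝ, E) p q) :=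
  contDiffAt_comp_symm hq (contMDiffAt_extChartAt_comp hq' hφ)

theorem fderiv_coordMap_chartDeriv {φ : M → N} {p q : M} {p' : N}
    (hq : q ∈ (extChartAt 𝓘(ℝ, E) p).source) (hq' : φ q ∈ (extChartAt 𝓘(ℝ, F) p').source)
    (hφ : ContMDiffAt 𝓘(ℝ, E) 𝓘(ℝ, F) 1 φ q) (v : TangentSpace 𝓘(ℝ, E) q) :
    fderiv ℝ (coordMap E F φ p p') (extChartAt 𝓘(ℝ, E) p q) (chartDeriv E p q v)
      = chartDeriv F p' (φ q) (mfderiv 𝓘(ℝ, E) 𝓘(ℝ, F) φ q v) := by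
  have h := fderiv_comp_symm_chartDeriv hq ((contDiffAt_comp_symm hq
    (contMDiffAt_extChartAt_comp (n := 1) hq' hφ)).differentiableAt one_ne_zero) v
  rw [mfderiv_comp q (mdifferentiableAt_extChartAt
    (by rwa [← extChartAt_source (I := 𝓘(ℝ, F))])) (hφ.mdifferentiableAt one_ne_zero)] at h
  exact h

end CoordinateMap

/-! ### Independence of the charts -/

section ChartChange

variable {E : Type*} [NormedAddCommGroup E] [NormedSpace ℝ E] [FiniteDimensional ℝ E]
  {M : Type*} [TopologicalSpace M] [ChartedSpace E M] [IsManifold 𝓘(ℝ, E) ∞ M]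
  [RiemannianBundle (fun x : M ↦ TangentSpace 𝓘(ℝ, E) x)]
  [IsContMDiffRiemannianBundle 𝓘(ℝ, E) ∞ E (fun x : M ↦ TangentSpace 𝓘(ℝ, E) x)]

omit [FiniteDimensional ℝ E] [RiemannianBundle (fun x : M ↦ TangentSpace 𝓘(ℝ, E) x)]
  [IsContMDiffRiemannianBundle 𝓘(ℝ, E) ∞ E (fun x : M ↦ TangentSpace 𝓘(ℝ, E) x)] in
theorem fderiv_coordMap_id_chartDeriv {p x q : M}
    (hx : q ∈ (extChartAt 𝓘(ℝ, E) x).source) (hp : q ∈ (extChartAt 𝓘(ℝ, E) p).source)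
    (v : TangentSpace 𝓘(ℝ, E) q) :
    fderiv ℝ (coordMap E E id x p) (extChartAt 𝓘(ℝ, E) x q) (chartDeriv E x q v)
      = chartDeriv E p q v := by
  have h := fderiv_coordMap_chartDeriv (F := E) (φ := (id : M → M)) hx hp contMDiffAt_id v
  rw [mfderiv_id] at h
  exact h

/-- A transition map is an isometry between the two coordinate expressions of the same metric, hence
totally geodesic. -/
theorem sff_chartTransition {p x : M} (hx : x ∈ (extChartAt 𝓘(ℝ, E) p).source) (v w : E) :
    sff (chartMetric x) (chartMetric p) (coordMap E E id x p) (extChartAt 𝓘(ℝ, E) x x) v w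
      = 0 := by
  have hxx := mem_extChartAt_source (I := 𝓘(ℝ, E)) x
  have hval : coordMap E E id x p (extChartAt 𝓘(ℝ, E) x x) = extChartAt 𝓘(ℝ, E) p x :=
    coordMap_extChartAt id p hxx
  refine sff_eq_zero_of_isometry (isMetricAt_chartMetric_of_mem_source hxx) ?_
    (contDiffAt_coordMap (n := 2) hxx hx contMDiffAt_id) ?_ ?_ v w
  · rw [hval]
    exact isMetricAt_chartMetric_of_mem_source hx
  · intro a
    obtain ⟨b, rfl⟩ := exists_chartDeriv_eq hx a
    exact ⟨_, fderiv_coordMap_id_chartDeriv hxx hx b⟩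
  · refine eventually_nhds_extChartAt hxx ?_
    filter_upwards [extChartAt_source_mem_nhds' hx] with q hp hq v w
    obtain ⟨v, rfl⟩ := exists_chartDeriv_eq hq v
    obtain ⟨w, rfl⟩ := exists_chartDeriv_eq hq w
    rw [coordMap_extChartAt id p hq, fderiv_coordMap_id_chartDeriv hq hp,
      fderiv_coordMap_id_chartDeriv hq hp, chartMetric_chartDeriv hq]
    exact (chartMetric_chartDeriv hp v w).symm

end ChartChange

section Maps

variable {E : Type*} [NormedAddCommGroup E] [NormedSpace ℝ E] [FiniteDimensional ℝ E]
  {M : Type*} [TopologicalSpace M] [ChartedSpace E M]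
  [RiemannianBundle (fun x : M ↦ TangentSpace 𝓘(ℝ, E) x)]
  {F : Type*} [NormedAddCommGroup F] [NormedSpace ℝ F] [FiniteDimensional ℝ F]
  {N : Type*} [TopologicalSpace N] [ChartedSpace F N]
  [RiemannianBundle (fun y : N ↦ TangentSpace 𝓘(ℝ, F) y)]

omit [FiniteDimensional ℝ E] [FiniteDimensional ℝ F] in
theorem secondFundamentalForm_eq_sff (φ : M → N) (x : M) (v w : TangentSpace 𝓘(ℝ, E) x) :
    secondFundamentalForm (E := E) (F := F) φ x v w
      = sff (chartMetric x) (chartMetric (φ x)) (coordMap E F φ x (φ x))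
        (extChartAt 𝓘(ℝ, E) x x) v w := by
  unfold sff
  rw [coordMap_extChartAt φ (φ x) (mem_extChartAt_source (I := 𝓘(ℝ, E)) x)]
  rfl

/-- The second fundamental form of a map as a bilinear map. -/
noncomputable def secondFundamentalFormₗ (φ : M → N) (x : M) :
    TangentSpace 𝓘(ℝ, E) x →ₗ[ℝ] TangentSpace 𝓘(ℝ, E) x →ₗ[ℝ] TangentSpace 𝓘(ℝ, F) (φ x) :=
  LinearMap.mk₂ ℝ (secondFundamentalForm (E := E) (F := F) φ x)
    (fun v v' w ↦ by
      simp only [secondFundamentalForm_eq_sff]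
      exact (sffₗ _ _ _ _).map_add₂ v v' w)
    (fun c v w ↦ by
      simp only [secondFundamentalForm_eq_sff]
      exact (sffₗ _ _ _ _).map_smul₂ c v w)
    (fun v w w' ↦ by
      simp only [secondFundamentalForm_eq_sff]
      exact (sffₗ _ _ _ _ v).map_add w w')
    (fun c v w ↦ by
      simp only [secondFundamentalForm_eq_sff]
      exact (sffₗ _ _ _ _ v).map_smul c w)

@[simp] theorem secondFundamentalFormₗ_apply (φ : M → N) (x : M)
    (v w : TangentSpace 𝓘(ℝ, E) x) :
    secondFundamentalFormₗ (E := E) (F := F) φ x v w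
      = secondFundamentalForm (E := E) (F := F) φ x v w := rfl

variable [IsManifold 𝓘(ℝ, E) ∞ M] [IsManifold 𝓘(ℝ, F) ∞ N]

/-- The expression of φ in one pair of charts, precomposed with a transition map, equals the
expression in the other pair followed by a transition map. Applying `sff_comp` to both sides leaves
only one term on each, since the transitions have zero second fundamental form. -/
theorem sff_coordMap_chartDeriv
    [IsContMDiffRiemannianBundle 𝓘(ℝ, E) ∞ E (fun x : M ↦ TangentSpace 𝓘(ℝ, E) x)]
    [IsContMDiffRiemannianBundle 𝓘(ℝ, F) ∞ F (fun y : N ↦ TangentSpace 𝓘(ℝ, F) y)]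
    {φ : M → N} {x p : M} {p' : N} (hφ : ContMDiffAt 𝓘(ℝ, E) 𝓘(ℝ, F) 2 φ x)
    (hp : x ∈ (extChartAt 𝓘(ℝ, E) p).source) (hp' : φ x ∈ (extChartAt 𝓘(ℝ, F) p').source)
    (v w : TangentSpace 𝓘(ℝ, E) x) :
    sff (chartMetric p) (chartMetric p') (coordMap E F φ p p') (extChartAt 𝓘(ℝ, E) p x)
        (chartDeriv E p x v) (chartDeriv E p x w)
      = chartDeriv F p' (φ x) (secondFundamentalForm (E := E) (F := F) φ x v w) := by
  have hxx := mem_extChartAt_source (I := 𝓘(ℝ, E)) x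
  have hφx := mem_extChartAt_source (I := 𝓘(ℝ, F)) (φ x)
  have hval : coordMap E E id x p (extChartAt 𝓘(ℝ, E) x x) = extChartAt 𝓘(ℝ, E) p x :=
    coordMap_extChartAt id p hxx
  have hval' : coordMap E F φ x (φ x) (extChartAt 𝓘(ℝ, E) x x) = extChartAt 𝓘(ℝ, F) (φ x) (φ x) :=
    coordMap_extChartAt φ (φ x) hxx
  have hev : coordMap E F φ p p' ∘ coordMap E E id x p
      =ᶠ[𝓝 (extChartAt 𝓘(ℝ, E) x x)] coordMap F F id (φ x) p' ∘ coordMap E F φ x (φ x) := by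
    refine eventually_nhds_extChartAt hxx ?_
    filter_upwards [extChartAt_source_mem_nhds' hp,
      hφ.continuousAt.eventually (extChartAt_source_mem_nhds (I := 𝓘(ℝ, F)) (φ x))] with q h1 h2 hq
    rw [Function.comp_apply, Function.comp_apply, coordMap_extChartAt id p hq,
      coordMap_extChartAt φ (φ x) hq]
    exact (coordMap_extChartAt φ p' h1).trans (coordMap_extChartAt id p' h2).symm
  have c1 := sff_comp (g := chartMetric x) (h := chartMetric p) (k := chartMetric p')
    (contDiffAt_coordMap (F := E) (n := 2) (φ := (id : M → M)) hxx hp contMDiffAt_id)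
    (χ := coordMap E F φ p p') (by rw [hval]; exact contDiffAt_coordMap (n := 2) hp hp' hφ) v w
  have c2 := sff_comp (g := chartMetric x) (h := chartMetric (φ x)) (k := chartMetric p')
    (contDiffAt_coordMap (n := 2) hxx hφx hφ) (χ := coordMap F F id (φ x) p')
    (by rw [hval']; exact contDiffAt_coordMap (F := F) (n := 2) hφx hp' contMDiffAt_id) v w
  have d1 : ∀ v : TangentSpace 𝓘(ℝ, E) x, fderiv ℝ (coordMap E E id x p) (extChartAt 𝓘(ℝ, E) x x) v
      = chartDeriv E p x v := fun v ↦ by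
    have := fderiv_coordMap_id_chartDeriv hxx hp v
    rwa [chartDeriv_self] at this
  have d2 : ∀ v : TangentSpace 𝓘(ℝ, F) (φ x), fderiv ℝ (coordMap F F id (φ x) p') (extChartAt 𝓘(ℝ, F) (φ x) (φ x)) v
      = chartDeriv F p' (φ x) v := fun v ↦ by
    have := fderiv_coordMap_id_chartDeriv hφx hp' v
    rwa [chartDeriv_self] at this
  rw [sff_congr hev v w, c2, sff_chartTransition hp v w, map_zero, zero_add, hval, hval',
    sff_chartTransition hp', add_zero, d1 v, d1 w] at c1
  rw [← c1, ← d2, secondFundamentalForm_eq_sff]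

end Maps

/-! ### Hessians and the composition formula -/

section Functions

variable {E : Type*} [NormedAddCommGroup E] [NormedSpace ℝ E] [FiniteDimensional ℝ E]
  {M : Type*} [TopologicalSpace M] [ChartedSpace E M]
  [RiemannianBundle (fun x : M ↦ TangentSpace 𝓘(ℝ, E) x)]

theorem inner_grad (u : M → ℝ) (x : M) (v : TangentSpace 𝓘(ℝ, E) x) :
    inner ℝ (grad u x) v = mvfderiv 𝓘(ℝ, E) u x v :=
  InnerProductSpace.toDual_symm_apply

/-- With the zero form in place of a metric on ℝ, a Hessian becomes a second fundamental form. This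
is legitimate because `sff_comp` requires nothing of the forms involved. -/
theorem christoffelOf_zero {F : Type*} [NormedAddCommGroup F] [NormedSpace ℝ F] (y v w : F) :
    christoffelOf (0 : F → F →L[ℝ] F →L[ℝ] ℝ) y v w = 0 := by
  simp [christoffelOf]

omit [FiniteDimensional ℝ E] in
theorem hessian_eq_sff (u : M → ℝ) (x : M) (v w : TangentSpace 𝓘(ℝ, E) x) :
    hessian E u x v w = sff (chartMetric x) 0 (u ∘ (extChartAt 𝓘(ℝ, E) x).symm)
      (extChartAt 𝓘(ℝ, E) x x) v w := by
  unfold sff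
  rw [christoffelOf_zero, add_zero]
  rfl

/-- The Hessian as a bilinear form. -/
noncomputable def hessianₗ (u : M → ℝ) (x : M) :
    TangentSpace 𝓘(ℝ, E) x →ₗ[ℝ] TangentSpace 𝓘(ℝ, E) x →ₗ[ℝ] ℝ :=
  LinearMap.mk₂ ℝ (hessian E u x)
    (fun v v' w ↦ by
      simp only [hessian_eq_sff]
      exact (sffₗ _ _ _ _).map_add₂ v v' w)
    (fun c v w ↦ by
      simp only [hessian_eq_sff]
      exact (sffₗ _ _ _ _).map_smul₂ c v w)
    (fun v w w' ↦ by
      simp only [hessian_eq_sff]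
      exact (sffₗ _ _ _ _ v).map_add w w')
    (fun c v w ↦ by
      simp only [hessian_eq_sff]
      exact (sffₗ _ _ _ _ v).map_smul c w)

@[simp] theorem hessianₗ_apply (u : M → ℝ) (x : M) (v w : TangentSpace 𝓘(ℝ, E) x) :
    hessianₗ u x v w = hessian E u x v w := rfl

variable [IsManifold 𝓘(ℝ, E) ∞ M]
  {F : Type*} [NormedAddCommGroup F] [NormedSpace ℝ F] [FiniteDimensional ℝ F]
  {N : Type*} [TopologicalSpace N] [ChartedSpace F N] [IsManifold 𝓘(ℝ, F) ∞ N]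
  [RiemannianBundle (fun y : N ↦ TangentSpace 𝓘(ℝ, F) y)]

omit [FiniteDimensional ℝ E] [RiemannianBundle (fun x : M ↦ TangentSpace 𝓘(ℝ, E) x)] in
theorem mvfderiv_eq_fderiv_comp_symm {u : M → ℝ} {x : M}
    (hu : DifferentiableAt ℝ (u ∘ (extChartAt 𝓘(ℝ, E) x).symm) (extChartAt 𝓘(ℝ, E) x x))
    (v : TangentSpace 𝓘(ℝ, E) x) :
    mvfderiv 𝓘(ℝ, E) u x v
      = fderiv ℝ (u ∘ (extChartAt 𝓘(ℝ, E) x).symm) (extChartAt 𝓘(ℝ, E) x x) v := by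
  have h := fderiv_comp_symm_chartDeriv (mem_extChartAt_source (I := 𝓘(ℝ, E)) x) hu v
  rw [chartDeriv_self] at h
  exact h.symm

omit [FiniteDimensional ℝ E] [RiemannianBundle (fun x : M ↦ TangentSpace 𝓘(ℝ, E) x)]
  [FiniteDimensional ℝ F] [RiemannianBundle (fun y : N ↦ TangentSpace 𝓘(ℝ, F) y)] in
theorem fderiv_coordMap_self {φ : M → N} {x : M} (hφ : ContMDiffAt 𝓘(ℝ, E) 𝓘(ℝ, F) 1 φ x)
    (v : TangentSpace 𝓘(ℝ, E) x) :
    fderiv ℝ (coordMap E F φ x (φ x)) (extChartAt 𝓘(ℝ, E) x x) v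
      = differential (E := E) (F := F) φ x v := by
  have h := fderiv_coordMap_chartDeriv (mem_extChartAt_source (I := 𝓘(ℝ, E)) x)
    (mem_extChartAt_source (I := 𝓘(ℝ, F)) (φ x)) hφ v
  rwa [chartDeriv_self, chartDeriv_self] at h

theorem hessian_comp {φ : M → N} {u : N → ℝ} {x : M}
    (hφ : ContMDiffAt 𝓘(ℝ, E) 𝓘(ℝ, F) 2 φ x) (hu : ContMDiffAt 𝓘(ℝ, F) 𝓘(ℝ, ℝ) 2 u (φ x))
    (v w : TangentSpace 𝓘(ℝ, E) x) :
    hessian E (u ∘ φ) x v w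
      = mvfderiv 𝓘(ℝ, F) u (φ x) (secondFundamentalForm (E := E) (F := F) φ x v w)
        + hessian F u (φ x) (differential (E := E) (F := F) φ x v)
          (differential (E := E) (F := F) φ x w) := by
  have hxx := mem_extChartAt_source (I := 𝓘(ℝ, E)) x
  have hφx := mem_extChartAt_source (I := 𝓘(ℝ, F)) (φ x)
  have hval : coordMap E F φ x (φ x) (extChartAt 𝓘(ℝ, E) x x) = extChartAt 𝓘(ℝ, F) (φ x) (φ x) :=
    coordMap_extChartAt φ (φ x) hxx
  have hu' : ContDiffAt ℝ 2 (u ∘ (extChartAt 𝓘(ℝ, F) (φ x)).symm)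
    (extChartAt 𝓘(ℝ, F) (φ x) (φ x)) := contDiffAt_comp_symm (n := 2) hφx hu
  have hev : (u ∘ φ) ∘ (extChartAt 𝓘(ℝ, E) x).symm =ᶠ[𝓝 (extChartAt 𝓘(ℝ, E) x x)]
      (u ∘ (extChartAt 𝓘(ℝ, F) (φ x)).symm) ∘ coordMap E F φ x (φ x) := by
    refine eventually_nhds_extChartAt hxx ?_
    filter_upwards [hφ.continuousAt.eventually
      (extChartAt_source_mem_nhds (I := 𝓘(ℝ, F)) (φ x))] with q h2 hq
    simp only [Function.comp_apply, coordMap_extChartAt φ (φ x) hq,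
      (extChartAt 𝓘(ℝ, F) (φ x)).left_inv h2, (extChartAt 𝓘(ℝ, E) x).left_inv hq]
  have hφ1 : ContMDiffAt 𝓘(ℝ, E) 𝓘(ℝ, F) 1 φ x := hφ.of_le (by norm_num)
  rw [hessian_eq_sff, sff_congr hev v w, sff_comp (h := chartMetric (φ x))
    (contDiffAt_coordMap (n := 2) hxx hφx hφ) (by rw [hval]; exact hu') v w, hval,
    ← secondFundamentalForm_eq_sff, ← mvfderiv_eq_fderiv_comp_symm
      (hu'.differentiableAt two_ne_zero), hessian_eq_sff,
    fderiv_coordMap_self hφ1, fderiv_coordMap_self hφ1]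

theorem laplacian_comp {φ : M → N} {u : N → ℝ} {x : M}
    (hφ : ContMDiffAt 𝓘(ℝ, E) 𝓘(ℝ, F) 2 φ x) (hu : ContMDiffAt 𝓘(ℝ, F) 𝓘(ℝ, ℝ) 2 u (φ x)) :
    laplacian E (u ∘ φ) x = mvfderiv 𝓘(ℝ, F) u (φ x) (tensionField (E := E) (F := F) φ x)
      + trace x fun v w ↦ hessian F u (φ x) (differential (E := E) (F := F) φ x v)
          (differential (E := E) (F := F) φ x w) := by
  simp only [laplacian, tensionField, trace, hessian_comp hφ hu, Finset.sum_add_distrib, map_sum]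

end Functions

/-! ### f-harmonic maps are f-harmonic morphisms -/

section Morphism

variable {E : Type*} [NormedAddCommGroup E] [NormedSpace ℝ E] [FiniteDimensional ℝ E]
  {M : Type*} [TopologicalSpace M] [ChartedSpace E M]
  [RiemannianBundle (fun x : M ↦ TangentSpace 𝓘(ℝ, E) x)]
  {F : Type*} [NormedAddCommGroup F] [NormedSpace ℝ F] [FiniteDimensional ℝ F]
  {N : Type*} [TopologicalSpace N] [ChartedSpace F N]
  [RiemannianBundle (fun y : N ↦ TangentSpace 𝓘(ℝ, F) y)]
  {φ : M → N} {lam : M → ℝ} {f : M → ℝ}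

theorem differential_apply_adjoint (hconf : IsHorizontallyWeaklyConformal E F φ)
    (hlam : IsDilation E F φ lam) {x : M} (hx : differential (E := E) (F := F) φ x ≠ 0)
    (ξ : TangentSpace 𝓘(ℝ, F) (φ x)) :
    differential (E := E) (F := F) φ x
      ((differential (E := E) (F := F) φ x).adjoint ξ) = lam x ^ 2 • ξ :=
  apply_adjoint_of_conformal (hconf x hx).1 ((hlam x).2 hx).2 ξ

/-- Vertical vectors contribute nothing. On the horizontal frame λ⁻¹ A* ξ_j the differential takes
the values λ ξ_j, whence the factor λ². At critical points both sides vanish. -/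
theorem trace_hessian_differential (hconf : IsHorizontallyWeaklyConformal E F φ)
    (hlam : IsDilation E F φ lam) (u : N → ℝ) (x : M) :
    (trace x fun v w ↦ hessian F u (φ x) (differential (E := E) (F := F) φ x v)
      (differential (E := E) (F := F) φ x w)) = lam x ^ 2 * laplacian F u (φ x) := by
  let B := (hessianₗ (E := F) u (φ x)).compl₁₂
    (differential (E := E) (F := F) φ x).toLinearMap
    (differential (E := E) (F := F) φ x).toLinearMap
  have hB : ∀ v w, B v w = hessian F u (φ x) (differential (E := E) (F := F) φ x v)
      (differential (E := E) (F := F) φ x w) := fun v w ↦ rfl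
  simp only [trace, laplacian, ← hB]
  by_cases hx : differential (E := E) (F := F) φ x = 0
  · have hz : ∀ v, B v = 0 := fun v ↦ by
      ext w
      change hessianₗ (E := F) u (φ x) (differential (E := E) (F := F) φ x v) _ = 0
      simp [hx]
    simp [hz, (hlam x).1 hx]
  · have hc := ((hlam x).2 hx).1.ne'
    have hA := differential_apply_adjoint hconf hlam hx
    rw [sum_orthonormalBasis_eq_add_of_conformal hc hA _
      (stdOrthonormalBasis ℝ _) (stdOrthonormalBasis ℝ (TangentSpace 𝓘(ℝ, F) (φ x)))]
    have h1 : ∀ v : LinearMap.ker (differential (E := E) (F := F) φ x).toLinearMap,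
        B v v = 0 := fun v ↦ by
      change hessianₗ (E := F) u (φ x) (differential (E := E) (F := F) φ x v) _ = 0
      have : differential (E := E) (F := F) φ x v = 0 := v.2
      rw [this, map_zero, LinearMap.zero_apply]
    have h2 : ∀ ξ, B ((differential (E := E) (F := F) φ x).adjoint ξ)
        ((differential (E := E) (F := F) φ x).adjoint ξ)
        = lam x ^ 2 * (lam x ^ 2 * hessian F u (φ x) ξ ξ) := fun ξ ↦ by
      change hessianₗ (E := F) u (φ x) (differential (E := E) (F := F) φ x _)
        (differential (E := E) (F := F) φ x _) = _
      rw [hA]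
      simp
    simp only [h1, h2, Finset.sum_const_zero, zero_add, ← Finset.mul_sum, smul_eq_mul]
    rw [inv_mul_cancel_left₀ (pow_ne_zero 2 hc)]

variable [IsManifold 𝓘(ℝ, E) ∞ M] [IsManifold 𝓘(ℝ, F) ∞ N]

theorem isFHarmonicMorphism_of_isFHarmonicMap (hφ : ContMDiff 𝓘(ℝ, E) 𝓘(ℝ, F) ∞ φ)
    (hconf : IsHorizontallyWeaklyConformal E F φ) (hlam : IsDilation E F φ lam)
    (H : IsFHarmonicMap E F f φ) : IsFHarmonicMorphism E F f φ := by
  have hφ2 : ContMDiff 𝓘(ℝ, E) 𝓘(ℝ, F) 2 φ := hφ.of_le ENat.LEInfty.out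
  refine ⟨hφ.continuous, fun V u hV _ hu ↦ ⟨?_, fun x hx ↦ ?_⟩⟩
  · exact hu.1.comp hφ2.contMDiffOn fun x hx ↦ hx
  · have hux : ContMDiffAt 𝓘(ℝ, F) 𝓘(ℝ, ℝ) 2 u (φ x) := hu.1.contMDiffAt (hV.mem_nhds hx)
    have h1 : mvfderiv 𝓘(ℝ, F) u (φ x) (fTensionField (E := E) (F := F) f φ x) = 0 := by
      rw [H x, map_zero]
    have h2 : mvfderiv 𝓘(ℝ, E) (u ∘ φ) x (grad f x)
        = mvfderiv 𝓘(ℝ, F) u (φ x) (differential (E := E) (F := F) φ x (grad f x)) := by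
      rw [mvfderiv, mfderiv_comp x (hux.mdifferentiableAt two_ne_zero)
        ((hφ2 x).mdifferentiableAt two_ne_zero)]
      rfl
    rw [fTensionField, map_add, map_smul, smul_eq_mul] at h1
    rw [laplacian_comp (hφ2 x) hux, trace_hessian_differential hconf hlam, hu.2 _ hx,
      real_inner_comm, inner_grad, h2]
    linear_combination h1

end Morphism

/-! ### Continuity of the f-tension field and critical points -/

section Continuity

variable {E F : Type*} [NormedAddCommGroup E] [NormedSpace ℝ E] [FiniteDimensional ℝ E]
  [NormedAddCommGroup F] [NormedSpace ℝ F] [FiniteDimensional ℝ F]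
  {g : E → E →L[ℝ] E →L[ℝ] ℝ} {h : F → F →L[ℝ] F →L[ℝ] ℝ} {ψ : E → F} {y : E}

theorem continuousAt_sff (hg : IsMetricAt g y) (hh : IsMetricAt h (ψ y))
    (hψ : ContDiffAt ℝ 2 ψ y) {v w : E → E} (hv : ContinuousAt v y) (hw : ContinuousAt w y) :
    ContinuousAt (fun z ↦ sff g h ψ z (v z) (w z)) y := by
  have hD : ContinuousAt (fderiv ℝ ψ) y :=
    (hψ.fderiv_right (m := 1) (by norm_num)).continuousAt
  have hDD : ContinuousAt (fderiv ℝ (fderiv ℝ ψ)) y :=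
    ((hψ.fderiv_right (m := 1) (by norm_num)).fderiv_right (m := 0) (by norm_num)).continuousAt
  unfold sff
  refine (((hDD.clm_apply hv).clm_apply hw).sub (hD.clm_apply ?_)).add ?_
  · exact hg.continuousAt_christoffelOf (η := fun z ↦ z) continuousAt_id hv hw
  · exact hh.continuousAt_christoffelOf (η := ψ) hψ.continuousAt (hD.clm_apply hv)
      (hD.clm_apply hw)

/-- The `f`-tension field in coordinates. -/
noncomputable def fTensionOf (g : E → E →L[ℝ] E →L[ℝ] ℝ) (h : F → F →L[ℝ] F →L[ℝ] ℝ)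
    (f : E → ℝ) (ψ : E → F) (y : E) : F :=
  f y • ∑ k, sff g h ψ y
      ((g y).inverse (LinearMap.toContinuousLinearMap ((Module.finBasis ℝ E).coord k)))
      (Module.finBasis ℝ E k)
    + fderiv ℝ ψ y ((g y).inverse (fderiv ℝ f y))

theorem continuousAt_fTensionOf (hg : IsMetricAt g y) (hh : IsMetricAt h (ψ y)) {f : E → ℝ}
    (hf : ContDiffAt ℝ 1 f y) (hψ : ContDiffAt ℝ 2 ψ y) :
    ContinuousAt (fTensionOf g h f ψ) y := by
  have hD : ContinuousAt (fderiv ℝ ψ) y :=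
    (hψ.fderiv_right (m := 1) (by norm_num)).continuousAt
  have hi : ContinuousAt (fun z ↦ (g z).inverse) y :=
    ContinuousAt.comp_of_eq (f := g)
      ((hg.isInvertible.contDiffAt_map_inverse (n := 0)).continuousAt)
      hg.contDiffAt.continuousAt rfl
  have hDf : ContinuousAt (fderiv ℝ f) y :=
    (hf.fderiv_right (m := 0) (by norm_num)).continuousAt
  unfold fTensionOf
  refine (hf.continuousAt.smul ?_).add (hD.clm_apply (hi.clm_apply hDf))
  exact tendsto_finsetSum _ fun k _ ↦
    continuousAt_sff hg hh hψ (hi.clm_apply continuousAt_const) continuousAt_const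

end Continuity

section Critical

variable {E : Type*} [NormedAddCommGroup E] [NormedSpace ℝ E] [FiniteDimensional ℝ E]
  {M : Type*} [TopologicalSpace M] [ChartedSpace E M] [IsManifold 𝓘(ℝ, E) ∞ M]
  [RiemannianBundle (fun x : M ↦ TangentSpace 𝓘(ℝ, E) x)]
  [IsContMDiffRiemannianBundle 𝓘(ℝ, E) ∞ E (fun x : M ↦ TangentSpace 𝓘(ℝ, E) x)]
  {F : Type*} [NormedAddCommGroup F] [NormedSpace ℝ F] [FiniteDimensional ℝ F]
  {N : Type*} [TopologicalSpace N] [ChartedSpace F N] [IsManifold 𝓘(ℝ, F) ∞ N]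
  [RiemannianBundle (fun y : N ↦ TangentSpace 𝓘(ℝ, F) y)]
  [IsContMDiffRiemannianBundle 𝓘(ℝ, F) ∞ F (fun y : N ↦ TangentSpace 𝓘(ℝ, F) y)]
  {φ : M → N} {f : M → ℝ}

theorem chartDeriv_grad {p x : M} (hp : x ∈ (extChartAt 𝓘(ℝ, E) p).source)
    (hf : DifferentiableAt ℝ (f ∘ (extChartAt 𝓘(ℝ, E) p).symm) (extChartAt 𝓘(ℝ, E) p x)) :
    chartDeriv E p x (grad f x) = (chartMetric p (extChartAt 𝓘(ℝ, E) p x)).inverse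
      (fderiv ℝ (f ∘ (extChartAt 𝓘(ℝ, E) p).symm) (extChartAt 𝓘(ℝ, E) p x)) := by
  have hg := isMetricAt_chartMetric_of_mem_source hp
  rw [← inverse_apply_of_isInvertible hg.isInvertible (chartDeriv E p x (grad f x))]
  congr 1
  ext v
  obtain ⟨v, rfl⟩ := exists_chartDeriv_eq hp v
  rw [chartMetric_chartDeriv hp, inner_grad, fderiv_comp_symm_chartDeriv hp hf]
  rfl

/-- The trace is rewritten over the coordinate basis of the fixed chart and its metric dual, so that
the right-hand side depends on x only through continuous coordinate data. -/
theorem chartDeriv_tensionField {x p : M} {p' : N} (hφ : ContMDiffAt 𝓘(ℝ, E) 𝓘(ℝ, F) 2 φ x)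
    (hp : x ∈ (extChartAt 𝓘(ℝ, E) p).source) (hp' : φ x ∈ (extChartAt 𝓘(ℝ, F) p').source) :
    chartDeriv F p' (φ x) (tensionField (E := E) (F := F) φ x)
      = ∑ k, sff (chartMetric p) (chartMetric p') (coordMap E F φ p p') (extChartAt 𝓘(ℝ, E) p x)
          ((chartMetric p (extChartAt 𝓘(ℝ, E) p x)).inverse
            (LinearMap.toContinuousLinearMap ((Module.finBasis ℝ E).coord k)))
          (Module.finBasis ℝ E k) := by
  have hg := isMetricAt_chartMetric_of_mem_source hp
  let A : TangentSpace 𝓘(ℝ, E) x ≃ₗ[ℝ] E :=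
    LinearEquiv.ofBijective (chartDeriv E p x).toLinearMap
      ⟨chartDeriv_injective hp, exists_chartDeriv_eq hp⟩
  have hA : ∀ v, chartDeriv E p x (A.symm v) = v := A.apply_symm_apply
  let e := (Module.finBasis ℝ E).map A.symm
  have he : ∀ k, chartDeriv E p x (e k) = Module.finBasis ℝ E k := fun k ↦ by
    simp only [e, Module.Basis.map_apply, hA]
  choose d hd using fun k ↦ exists_chartDeriv_eq hp
    ((chartMetric p (extChartAt 𝓘(ℝ, E) p x)).inverse
      (LinearMap.toContinuousLinearMap ((Module.finBasis ℝ E).coord k)))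
  have hde : ∀ k v, inner ℝ (d k) v = e.repr v k := fun k v ↦ by
    rw [← chartMetric_chartDeriv hp, hd, apply_inverse_of_isInvertible hg.isInvertible]
    rfl
  have h := sum_orthonormalBasis_eq_sum_dual (stdOrthonormalBasis ℝ (TangentSpace 𝓘(ℝ, E) x)) e
    hde (secondFundamentalFormₗ (E := E) (F := F) φ x)
  simp only [secondFundamentalFormₗ_apply] at h
  rw [tensionField, trace, h, map_sum]
  refine Finset.sum_congr rfl fun k _ ↦ ?_
  rw [← sff_coordMap_chartDeriv hφ hp hp', hd, he]

theorem chartDeriv_fTensionField {x p : M} {p' : N} (hφ : ContMDiffAt 𝓘(ℝ, E) 𝓘(ℝ, F) 2 φ x)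
    (hf : ContMDiffAt 𝓘(ℝ, E) 𝓘(ℝ, ℝ) 1 f x)
    (hp : x ∈ (extChartAt 𝓘(ℝ, E) p).source) (hp' : φ x ∈ (extChartAt 𝓘(ℝ, F) p').source) :
    chartDeriv F p' (φ x) (fTensionField (E := E) (F := F) f φ x)
      = fTensionOf (chartMetric p) (chartMetric p') (f ∘ (extChartAt 𝓘(ℝ, E) p).symm)
        (coordMap E F φ p p') (extChartAt 𝓘(ℝ, E) p x) := by
  have hφ1 : ContMDiffAt 𝓘(ℝ, E) 𝓘(ℝ, F) 1 φ x := hφ.of_le (by norm_num)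
  have hf' := (contDiffAt_comp_symm (n := 1) hp hf).differentiableAt one_ne_zero
  rw [fTensionField, fTensionOf, map_add, map_smul, chartDeriv_tensionField hφ hp hp',
    ← chartDeriv_grad hp hf', fderiv_coordMap_chartDeriv hp hp' hφ1, Function.comp_apply,
    (extChartAt 𝓘(ℝ, E) p).left_inv hp]

/-- The set where the `f`-tension field vanishes is closed. -/
theorem fTensionField_eq_zero_of_frequently (hφ : ContMDiff 𝓘(ℝ, E) 𝓘(ℝ, F) 2 φ)
    (hf : ContMDiff 𝓘(ℝ, E) 𝓘(ℝ, ℝ) 1 f) {x : M}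
    (h : ∃ᶠ q in 𝓝 x, fTensionField (E := E) (F := F) f φ q = 0) :
    fTensionField (E := E) (F := F) f φ x = 0 := by
  have hxx := mem_extChartAt_source (I := 𝓘(ℝ, E)) x
  have hφx := mem_extChartAt_source (I := 𝓘(ℝ, F)) (φ x)
  refine chartDeriv_injective hφx ?_
  rw [map_zero, chartDeriv_fTensionField (hφ x) (hf x) hxx hφx]
  by_contra hne
  -- In fixed charts around x, a nonzero value persists nearby by continuity, contradicting the
  -- zeros arbitrarily close to x.
  refine h ?_
  have hc := continuousAt_fTensionOf (isMetricAt_chartMetric_of_mem_source hxx)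
    (by rw [coordMap_extChartAt φ (φ x) hxx]; exact isMetricAt_chartMetric_of_mem_source hφx)
    (contDiffAt_comp_symm (n := 1) hxx (hf x)) (contDiffAt_coordMap (n := 2) hxx hφx (hφ x))
  filter_upwards [(continuousAt_extChartAt (I := 𝓘(ℝ, E)) x).eventually (hc.eventually_ne hne),
    extChartAt_source_mem_nhds (I := 𝓘(ℝ, E)) x,
    (hφ x).continuousAt.eventually (extChartAt_source_mem_nhds (I := 𝓘(ℝ, F)) (φ x))]
    with q hq h1 h2 hz
  rw [← chartDeriv_fTensionField (hφ q) (hf q) h1 h2, hz, map_zero] at hq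
  exact hq rfl

omit [IsContMDiffRiemannianBundle 𝓘(ℝ, E) ∞ E (fun x : M ↦ TangentSpace 𝓘(ℝ, E) x)]
  [IsContMDiffRiemannianBundle 𝓘(ℝ, F) ∞ F (fun y : N ↦ TangentSpace 𝓘(ℝ, F) y)] in
theorem fTensionField_eq_zero_of_eventually_const (hφ : ContMDiff 𝓘(ℝ, E) 𝓘(ℝ, F) 2 φ) {x : M}
    (h : ∀ᶠ q in 𝓝 x, differential (E := E) (F := F) φ q = 0) :
    fTensionField (E := E) (F := F) f φ x = 0 := by
  have hxx := mem_extChartAt_source (I := 𝓘(ℝ, E)) x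
  have hev : fderiv ℝ (coordMap E F φ x (φ x)) =ᶠ[𝓝 (extChartAt 𝓘(ℝ, E) x x)] 0 := by
    refine eventually_nhds_extChartAt hxx ?_
    filter_upwards [h, (hφ x).continuousAt.eventually
      (extChartAt_source_mem_nhds (I := 𝓘(ℝ, F)) (φ x))] with q h1 h2 hq
    ext v
    obtain ⟨v, rfl⟩ := exists_chartDeriv_eq hq v
    rw [fderiv_coordMap_chartDeriv hq h2 ((hφ q).of_le (by norm_num))]
    change chartDeriv F (φ x) (φ q) (differential (E := E) (F := F) φ q v) = 0
    rw [h1]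
    exact map_zero _
  have hs : ∀ v w : E, sff (chartMetric x) (chartMetric (φ x)) (coordMap E F φ x (φ x))
      (extChartAt 𝓘(ℝ, E) x x) v w = 0 := fun v w ↦ by
    unfold sff
    rw [hev.fderiv_eq, hev.self_of_nhds]
    simp [christoffelOf]
  have hz : ∀ v w, secondFundamentalForm (E := E) (F := F) φ x v w = 0 := fun v w ↦ by
    rw [secondFundamentalForm_eq_sff]
    exact hs v w
  rw [fTensionField, h.self_of_nhds]
  simp [tensionField, trace, hz]

end Critical

/-- The extension is constant in the trivialization at x, which acts on tangent spaces as the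
differential of the chart at x. -/
theorem chartDeriv_extend {E : Type*} [NormedAddCommGroup E] [NormedSpace ℝ E]
    {M : Type*} [TopologicalSpace M] [ChartedSpace E M] [IsManifold 𝓘(ℝ, E) ∞ M]
    {x q : M} (hq : q ∈ (extChartAt 𝓘(ℝ, E) x).source) (w : TangentSpace 𝓘(ℝ, E) x) :
    chartDeriv E x q (FiberBundle.extend E (E := fun z : M ↦ TangentSpace 𝓘(ℝ, E) z) w q)
      = w := by
  have hq' : q ∈ (chartAt E x).source := by rwa [← extChartAt_source (I := 𝓘(ℝ, E))]
  have hb : q ∈ (trivializationAt E (TangentSpace 𝓘(ℝ, E)) x).baseSet := by simpa using hq'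
  have hbx : x ∈ (trivializationAt E (TangentSpace 𝓘(ℝ, E)) x).baseSet := by simp
  have h1 := TangentBundle.continuousLinearMapAt_trivializationAt (I := 𝓘(ℝ, E)) hq'
  have h2 := TangentBundle.continuousLinearMapAt_trivializationAt (I := 𝓘(ℝ, E))
    (mem_chart_source E x)
  have h3 : ((trivializationAt E (TangentSpace 𝓘(ℝ, E)) x) ⟨x, w⟩).2
      = chartDeriv E x x w := by
    rw [chartDeriv, ← h2]
    exact (congrFun ((trivializationAt E (TangentSpace 𝓘(ℝ, E)) x).coe_linearMapAt_of_mem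
      (R := ℝ) hbx) w).symm
  rw [chartDeriv, ← h1, FiberBundle.extend, h3, chartDeriv_self]
  have h4 := (trivializationAt E (TangentSpace 𝓘(ℝ, E)) x).continuousLinearMapAt_symmL
    (R := ℝ) hb w
  refine Eq.trans (congrArg _ ?_) h4
  exact (Bundle.Trivialization.symmL_apply (R := ℝ)
    (trivializationAt E (TangentSpace 𝓘(ℝ, E)) x) hb w).symm

theorem differential_eq_zero_of_mem {E : Type*} [NormedAddCommGroup E] [NormedSpace ℝ E]
    {M : Type*} [TopologicalSpace M] [ChartedSpace E M]
    {F : Type*} [NormedAddCommGroup F] [NormedSpace ℝ F]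
    {N : Type*} [TopologicalSpace N] [ChartedSpace F N] {φ : M → N} {x : M}
    {v : TangentSpace 𝓘(ℝ, E) x} (hv : v ∈ verticalSpace (E := E) (F := F) φ x) :
    differential (E := E) (F := F) φ x v = 0 := hv

/-! ### The fundamental formula at regular points -/

section Key

variable {E : Type*} [NormedAddCommGroup E] [NormedSpace ℝ E] [FiniteDimensional ℝ E]
  {M : Type*} [TopologicalSpace M] [ChartedSpace E M] [IsManifold 𝓘(ℝ, E) ∞ M]
  [RiemannianBundle (fun x : M ↦ TangentSpace 𝓘(ℝ, E) x)]
  {F : Type*} [NormedAddCommGroup F] [NormedSpace ℝ F] [FiniteDimensional ℝ F]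
  {N : Type*} [TopologicalSpace N] [ChartedSpace F N] [IsManifold 𝓘(ℝ, F) ∞ N]
  [RiemannianBundle (fun y : N ↦ TangentSpace 𝓘(ℝ, F) y)]
  {φ : M → N} {lam f : M → ℝ} {x : M}

theorem eventually_differential_ne_zero (hφ : ContMDiff 𝓘(ℝ, E) 𝓘(ℝ, F) 1 φ)
    (hx : differential (E := E) (F := F) φ x ≠ 0) :
    ∀ᶠ q in 𝓝 x, differential (E := E) (F := F) φ q ≠ 0 := by
  have hxx := mem_extChartAt_source (I := 𝓘(ℝ, E)) x
  have hφx := mem_extChartAt_source (I := 𝓘(ℝ, F)) (φ x)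
  have hne : fderiv ℝ (coordMap E F φ x (φ x)) (extChartAt 𝓘(ℝ, E) x x) ≠ 0 := by
    intro h
    refine hx (ContinuousLinearMap.ext fun v ↦ ?_)
    rw [← fderiv_coordMap_self (hφ x), h]
    rfl
  have hc : ContinuousAt (fderiv ℝ (coordMap E F φ x (φ x))) (extChartAt 𝓘(ℝ, E) x x) :=
    ((contDiffAt_coordMap (n := 1) hxx hφx (hφ x)).fderiv_right (m := 0)
      (by norm_num)).continuousAt
  filter_upwards [(continuousAt_extChartAt (I := 𝓘(ℝ, E)) x).eventually (hc.eventually_ne hne),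
    extChartAt_source_mem_nhds (I := 𝓘(ℝ, E)) x,
    (hφ x).continuousAt.eventually (extChartAt_source_mem_nhds (I := 𝓘(ℝ, F)) (φ x))]
    with q hq h1 h2 hz
  refine hq (ContinuousLinearMap.ext fun v ↦ ?_)
  obtain ⟨v, rfl⟩ := exists_chartDeriv_eq h1 v
  rw [fderiv_coordMap_chartDeriv h1 h2 (hφ q)]
  change chartDeriv F (φ x) (φ q) (differential (E := E) (F := F) φ q v) = 0
  rw [hz]
  exact map_zero _

variable [IsContMDiffRiemannianBundle 𝓘(ℝ, E) ∞ E (fun x : M ↦ TangentSpace 𝓘(ℝ, E) x)]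

theorem formAdjoint_chartDeriv {p q : M} {p' : N} (hφ : ContMDiffAt 𝓘(ℝ, E) 𝓘(ℝ, F) 1 φ q)
    (hq : q ∈ (extChartAt 𝓘(ℝ, E) p).source) (hq' : φ q ∈ (extChartAt 𝓘(ℝ, F) p').source)
    (ξ : TangentSpace 𝓘(ℝ, F) (φ q)) :
    formAdjoint (chartMetric p (extChartAt 𝓘(ℝ, E) p q))
        (chartMetric p' (coordMap E F φ p p' (extChartAt 𝓘(ℝ, E) p q)))
        (fderiv ℝ (coordMap E F φ p p') (extChartAt 𝓘(ℝ, E) p q)) (chartDeriv F p' (φ q) ξ)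
      = chartDeriv E p q ((differential (E := E) (F := F) φ q).adjoint ξ) := by
  have hg := isMetricAt_chartMetric_of_mem_source hq
  refine eq_of_forall_apply_eq hg.pos_self fun v ↦ ?_
  obtain ⟨v, rfl⟩ := exists_chartDeriv_eq hq v
  rw [apply_formAdjoint hg.isInvertible, chartMetric_chartDeriv hq,
    fderiv_coordMap_chartDeriv hq hq' hφ, coordMap_extChartAt φ p' hq,
    chartMetric_chartDeriv hq', ContinuousLinearMap.adjoint_inner_left]

theorem formAdjoint_self (hφ : ContMDiffAt 𝓘(ℝ, E) 𝓘(ℝ, F) 1 φ x)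
    (ξ : TangentSpace 𝓘(ℝ, F) (φ x)) :
    formAdjoint (chartMetric x (extChartAt 𝓘(ℝ, E) x x))
        (chartMetric (φ x) (coordMap E F φ x (φ x) (extChartAt 𝓘(ℝ, E) x x)))
        (fderiv ℝ (coordMap E F φ x (φ x)) (extChartAt 𝓘(ℝ, E) x x)) ξ
      = (differential (E := E) (F := F) φ x).adjoint ξ := by
  have h := formAdjoint_chartDeriv hφ (mem_extChartAt_source (I := 𝓘(ℝ, E)) x)
    (mem_extChartAt_source (I := 𝓘(ℝ, F)) (φ x)) ξ
  rwa [chartDeriv_self, chartDeriv_self] at h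

variable [IsContMDiffRiemannianBundle 𝓘(ℝ, F) ∞ F (fun y : N ↦ TangentSpace 𝓘(ℝ, F) y)]

theorem isConformalAt_coordMap (hφ : ContMDiff 𝓘(ℝ, E) 𝓘(ℝ, F) 2 φ)
    (hconf : IsHorizontallyWeaklyConformal E F φ) (hlam : IsDilation E F φ lam)
    (hx : differential (E := E) (F := F) φ x ≠ 0) :
    IsConformalAt (chartMetric x) (chartMetric (φ x)) (coordMap E F φ x (φ x))
      (fun z ↦ lam ((extChartAt 𝓘(ℝ, E) x).symm z) ^ 2) (extChartAt 𝓘(ℝ, E) x x) := by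
  have hxx := mem_extChartAt_source (I := 𝓘(ℝ, E)) x
  have hφx := mem_extChartAt_source (I := 𝓘(ℝ, F)) (φ x)
  have hφ1 : ContMDiff 𝓘(ℝ, E) 𝓘(ℝ, F) 1 φ := hφ.of_le (by norm_num)
  have hev := eventually_differential_ne_zero hφ1 hx
  refine ⟨isMetricAt_chartMetric_of_mem_source hxx, ?_,
    contDiffAt_coordMap (n := 2) hxx hφx (hφ x), ?_, ?_⟩
  · rw [coordMap_extChartAt φ (φ x) hxx]
    exact isMetricAt_chartMetric_of_mem_source hφx
  · refine eventually_nhds_extChartAt hxx ?_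
    filter_upwards [hev] with q hne hq
    rw [(extChartAt 𝓘(ℝ, E) x).left_inv hq]
    exact pow_pos ((hlam q).2 hne).1 2
  · refine eventually_nhds_extChartAt hxx ?_
    filter_upwards [hev, hφ.continuous.continuousAt.eventually
      (extChartAt_source_mem_nhds (I := 𝓘(ℝ, F)) (φ x))] with q hne hq' hq ξ
    obtain ⟨ξ, rfl⟩ := exists_chartDeriv_eq hq' ξ
    rw [formAdjoint_chartDeriv (hφ1 q) hq hq', fderiv_coordMap_chartDeriv hq hq' (hφ1 q),
      (extChartAt 𝓘(ℝ, E) x).left_inv hq, ← map_smul,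
      ← differential_apply_adjoint hconf hlam hne]

/-- The extension W satisfies dφ(W) = 0 near x, and this equation is differentiated by
`fderiv_covariant_of_vertical`. The remaining work is to show that W is differentiable in
coordinates. -/
theorem differential_covDeriv_verticalExtension (hφ : ContMDiff 𝓘(ℝ, E) 𝓘(ℝ, F) 2 φ)
    (hconf : IsHorizontallyWeaklyConformal E F φ) (hlam : IsDilation E F φ lam)
    (hx : differential (E := E) (F := F) φ x ≠ 0) (v w : TangentSpace 𝓘(ℝ, E) x)
    (hw : w ∈ verticalSpace (E := E) (F := F) φ x) :
    differential (E := E) (F := F) φ x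
        (covDeriv (verticalExtension (E := E) (F := F) φ x w) x v)
      = - secondFundamentalForm (E := E) (F := F) φ x v w := by
  have hxx := mem_extChartAt_source (I := 𝓘(ℝ, E)) x
  have hφ1 : ContMDiff 𝓘(ℝ, E) 𝓘(ℝ, F) 1 φ := hφ.of_le (by norm_num)
  have H := isConformalAt_coordMap hφ hconf hlam hx
  obtain ⟨w', hw'⟩ : ∃ w' : E, w' = w := ⟨w, rfl⟩
  have hval : verticalExtension (E := E) (F := F) φ x w x = w := by
    rw [verticalExtension, FiberBundle.extend_apply_self]
    exact Submodule.starProjection_eq_self_iff.2 hw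
  have hcongr : ∀ q q', q = q' → chartDeriv E x q (verticalExtension (E := E) (F := F) φ x w q)
      = chartDeriv E x q' (verticalExtension (E := E) (F := F) φ x w q') := by
    rintro q _ rfl
    rfl
  set ψ := coordMap E F φ x (φ x) with hψ
  set y := extChartAt 𝓘(ℝ, E) x x with hy
  set W : E → E := fun z ↦ chartDeriv E x ((extChartAt 𝓘(ℝ, E) x).symm z)
    (verticalExtension (E := E) (F := F) φ x w ((extChartAt 𝓘(ℝ, E) x).symm z)) with hW
  have hnt : Nontrivial F := by
    by_contra hn
    rw [not_nontrivial_iff_subsingleton] at hn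
    exact hx (ContinuousLinearMap.ext fun v ↦ hn.elim _ _)
  have hWq : ∀ q ∈ (extChartAt 𝓘(ℝ, E) x).source, W (extChartAt 𝓘(ℝ, E) x q)
      = chartDeriv E x q (verticalExtension (E := E) (F := F) φ x w q) := fun q hq ↦
    hcongr _ _ ((extChartAt 𝓘(ℝ, E) x).left_inv hq)
  have hWy : W y = w' := by
    rw [hWq x hxx, chartDeriv_self, hval, hw']
  -- In coordinates the vertical projection of the constant field w' is w' - μ⁻¹ A* A w', with μ =
  -- λ².
  have hev : W =ᶠ[𝓝 y] fun z ↦ w' - (lam ((extChartAt 𝓘(ℝ, E) x).symm z) ^ 2)⁻¹ •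
      formAdjoint (chartMetric x z) (chartMetric (φ x) (ψ z)) (fderiv ℝ ψ z)
        (fderiv ℝ ψ z w') := by
    refine eventually_nhds_extChartAt hxx ?_
    filter_upwards [eventually_differential_ne_zero hφ1 hx,
      hφ.continuous.continuousAt.eventually
      (extChartAt_source_mem_nhds (I := 𝓘(ℝ, F)) (φ x))] with q hne hq' hq
    have hex := (chartDeriv_extend hq w).trans hw'.symm
    rw [hWq q hq, (extChartAt 𝓘(ℝ, E) x).left_inv hq]
    have hs := starProjection_ker_of_conformal ((hlam q).2 hne).1.ne'
      (differential_apply_adjoint hconf hlam hne)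
      (FiberBundle.extend E (E := fun z : M ↦ TangentSpace 𝓘(ℝ, E) z) w q)
    have hs' := congrArg (chartDeriv E x q) hs
    rw [map_sub, map_smul, ← formAdjoint_chartDeriv (hφ1 q) hq hq',
      ← fderiv_coordMap_chartDeriv hq hq' (hφ1 q), hex] at hs'
    exact hs'
  have hWd : DifferentiableAt ℝ W y := by
    refine DifferentiableAt.congr_of_eventuallyEq ?_ hev
    have h1 := (contDiffAt_formAdjoint H.domain H.target H.contDiffAt).differentiableAt
      one_ne_zero
    have h2 := (hasFDerivAt_fderiv H.contDiffAt).differentiableAt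
    exact (differentiableAt_const _).sub
      ((H.differentiableAt_dilation.fun_inv H.pos.self_of_nhds.ne').smul
        (h1.clm_apply (h2.clm_apply (differentiableAt_const _))))
  have hker : ∀ᶠ z in 𝓝 y, fderiv ℝ ψ z (W z) = 0 := by
    filter_upwards [hev, H.apply_adjoint, H.pos] with z h1 h2 h3
    rw [h1, map_sub, map_smul, h2, smul_smul, inv_mul_cancel₀ h3.ne', one_smul, sub_self]
  have h := fderiv_covariant_of_vertical (g := chartMetric x) (h := chartMetric (φ x))
    H.contDiffAt hWd hker v
  rw [hWy] at h
  subst hw'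
  refine (fderiv_coordMap_self (hφ1 x) _).symm.trans (Eq.trans ?_
    (h.trans (congrArg Neg.neg (secondFundamentalForm_eq_sff φ x v w').symm)))
  rw [covDeriv, hval]
  rfl

/-- Passing to the horizontal part changes the covariant derivative by a vertical vector, which dφ
kills. -/
theorem differential_fiberSecondFundamentalForm (hφ : ContMDiff 𝓘(ℝ, E) 𝓘(ℝ, F) 2 φ)
    (hconf : IsHorizontallyWeaklyConformal E F φ) (hlam : IsDilation E F φ lam)
    (hx : differential (E := E) (F := F) φ x ≠ 0) (v w : TangentSpace 𝓘(ℝ, E) x)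
    (hw : w ∈ verticalSpace (E := E) (F := F) φ x) :
    differential (E := E) (F := F) φ x (fiberSecondFundamentalForm (E := E) (F := F) φ x v w)
      = - secondFundamentalForm (E := E) (F := F) φ x v w := by
  rw [← differential_covDeriv_verticalExtension hφ hconf hlam hx v w hw,
    fiberSecondFundamentalForm]
  have h0 : ∀ z, (horizontalSpace (E := E) (F := F) φ x).starProjection z
      = z - (verticalSpace (E := E) (F := F) φ x).starProjection z :=
    Submodule.starProjection_orthogonal_val
  rw [h0, map_sub]
  rw [differential_eq_zero_of_mem (Submodule.starProjection_apply_mem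
    (verticalSpace (E := E) (F := F) φ x)
    (covDeriv (verticalExtension (E := E) (F := F) φ x w) x v)), sub_zero]

variable (E F) in
/-- The trace of the second fundamental form of the fiber. -/
noncomputable def fiberTrace (φ : M → N) (x : M) : TangentSpace 𝓘(ℝ, E) x :=
  ∑ i, fiberSecondFundamentalForm (E := E) (F := F) φ x
    (stdOrthonormalBasis ℝ (verticalSpace (E := E) (F := F) φ x) i)
    (stdOrthonormalBasis ℝ (verticalSpace (E := E) (F := F) φ x) i)

/-- The tension field of a horizontally conformal map at a regular point. -/
theorem inner_tensionField (hφ : ContMDiff 𝓘(ℝ, E) 𝓘(ℝ, F) 2 φ)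
    (hconf : IsHorizontallyWeaklyConformal E F φ) (hlam : IsDilation E F φ lam)
    (hx : differential (E := E) (F := F) φ x ≠ 0) (η : TangentSpace 𝓘(ℝ, F) (φ x)) :
    inner ℝ (tensionField (E := E) (F := F) φ x) η
      = - inner ℝ (differential (E := E) (F := F) φ x (fiberTrace E F φ x)) η
        + (lam x ^ 2)⁻¹ * ((1 - (Module.finrank ℝ F : ℝ) / 2)
          * fderiv ℝ (fun z ↦ lam ((extChartAt 𝓘(ℝ, E) x).symm z) ^ 2) (extChartAt 𝓘(ℝ, E) x x)
            ((differential (E := E) (F := F) φ x).adjoint η)) := by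
  have hxx := mem_extChartAt_source (I := 𝓘(ℝ, E)) x
  have hφ1 : ContMDiff 𝓘(ℝ, E) 𝓘(ℝ, F) 1 φ := hφ.of_le (by norm_num)
  have H := isConformalAt_coordMap hφ hconf hlam hx
  have hnt : Nontrivial F := by
    by_contra hn
    rw [not_nontrivial_iff_subsingleton] at hn
    exact hx (ContinuousLinearMap.ext fun v ↦ hn.elim _ _)
  have hc := ((hlam x).2 hx).1.ne'
  let ξ := stdOrthonormalBasis ℝ (TangentSpace 𝓘(ℝ, F) (φ x))
  have hvert : ∑ i, secondFundamentalForm (E := E) (F := F) φ x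
      (stdOrthonormalBasis ℝ (verticalSpace (E := E) (F := F) φ x) i)
      (stdOrthonormalBasis ℝ (verticalSpace (E := E) (F := F) φ x) i)
      = - differential (E := E) (F := F) φ x (fiberTrace E F φ x) := by
    rw [fiberTrace, map_sum, ← Finset.sum_neg_distrib]
    refine Finset.sum_congr rfl fun i _ ↦ ?_
    rw [differential_fiberSecondFundamentalForm hφ hconf hlam hx _ _ (Subtype.coe_prop _),
      neg_neg]
  have hsplit := (sum_orthonormalBasis_eq_add_of_conformal hc
    (differential_apply_adjoint hconf hlam hx)
    (stdOrthonormalBasis ℝ (TangentSpace 𝓘(ℝ, E) x))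
    (stdOrthonormalBasis ℝ (verticalSpace (E := E) (F := F) φ x)) ξ
    (secondFundamentalFormₗ (E := E) (F := F) φ x)).trans (congrArg (· + _) hvert)
  simp only [secondFundamentalFormₗ_apply] at hsplit
  have hmet : ∀ a b : TangentSpace 𝓘(ℝ, F) (φ x),
      chartMetric (φ x) (coordMap E F φ x (φ x) (extChartAt 𝓘(ℝ, E) x x)) a b = inner ℝ a b := by
    intro a b
    rw [coordMap_extChartAt φ (φ x) hxx]
    exact chartMetric_self (φ x) a b
  have hhor := H.sum_sff_adjoint (ξ := ξ)
    (fun i ↦ by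
      refine (hmet _ _).trans ?_
      rw [real_inner_self_eq_norm_sq, ξ.orthonormal.1 i, one_pow])
    (fun η ↦ by
      refine Eq.trans ?_ (ξ.sum_repr' η)
      exact Finset.sum_congr rfl fun i _ ↦ congrArg (· • ξ i) (hmet _ _)) η
  have hhor' : inner ℝ (∑ j, secondFundamentalForm (E := E) (F := F) φ x
      ((differential (E := E) (F := F) φ x).adjoint (ξ j))
      ((differential (E := E) (F := F) φ x).adjoint (ξ j))) η
      = (1 - (Module.finrank ℝ F : ℝ) / 2)
          * fderiv ℝ (fun z ↦ lam ((extChartAt 𝓘(ℝ, E) x).symm z) ^ 2) (extChartAt 𝓘(ℝ, E) x x)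
            ((differential (E := E) (F := F) φ x).adjoint η) := by
    rw [Fintype.card_fin, formAdjoint_self (hφ1 x) η] at hhor
    refine Eq.trans ?_ hhor
    rw [← hmet]
    congr 2
    refine Finset.sum_congr rfl fun j _ ↦ ?_
    rw [secondFundamentalForm_eq_sff, formAdjoint_self (hφ1 x)]
  rw [tensionField, trace, hsplit, inner_add_left, inner_neg_left, real_inner_smul_left,
    hhor']

/-- The fundamental formula for the `f`-tension field of a horizontally conformal map. -/
theorem inner_fTensionField (hφ : ContMDiff 𝓘(ℝ, E) 𝓘(ℝ, F) 2 φ)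
    (hconf : IsHorizontallyWeaklyConformal E F φ) (hlam : IsDilation E F φ lam)
    (hf : ContMDiff 𝓘(ℝ, E) 𝓘(ℝ, ℝ) 1 f)
    (hx : differential (E := E) (F := F) φ x ≠ 0) (η : TangentSpace 𝓘(ℝ, F) (φ x)) :
    inner ℝ (fTensionField (E := E) (F := F) f φ x) η
      = - f x * inner ℝ (differential (E := E) (F := F) φ x (fiberTrace E F φ x)) η
        + (lam x ^ (2 - (Module.finrank ℝ F : ℤ)))⁻¹
          * inner ℝ (differential (E := E) (F := F) φ x
            (grad (fun x ↦ f x * lam x ^ (2 - (Module.finrank ℝ F : ℤ))) x)) η := by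
  have hxx := mem_extChartAt_source (I := 𝓘(ℝ, E)) x
  have H := isConformalAt_coordMap hφ hconf hlam hx
  have hnt : Nontrivial F := by
    by_contra hn
    rw [not_nontrivial_iff_subsingleton] at hn
    exact hx (ContinuousLinearMap.ext fun v ↦ hn.elim _ _)
  have hpos := ((hlam x).2 hx).1
  set y := extChartAt 𝓘(ℝ, E) x x with hy
  set l : E → ℝ := lam ∘ (extChartAt 𝓘(ℝ, E) x).symm with hl
  have hly : l y = lam x := by simp [hl, hy]
  have hμ : DifferentiableAt ℝ (fun z ↦ l z ^ 2) y := H.differentiableAt_dilation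
  have hlpos : ∀ᶠ z in 𝓝 y, 0 < l z := by
    refine eventually_nhds_extChartAt hxx ?_
    filter_upwards [eventually_differential_ne_zero (hφ.of_le (by norm_num)) hx] with q hne hq
    simp only [hl, Function.comp_apply, (extChartAt 𝓘(ℝ, E) x).left_inv hq]
    exact ((hlam q).2 hne).1
  -- Only λ² is known to be differentiable so far; λ > 0 near x allows taking the square root.
  have hld : DifferentiableAt ℝ l y := by
    refine DifferentiableAt.congr_of_eventuallyEq (hμ.sqrt (by rw [hly]; positivity)) ?_
    filter_upwards [hlpos] with z hz
    exact (Real.sqrt_sq hz.le).symm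
  have hfd : DifferentiableAt ℝ (f ∘ (extChartAt 𝓘(ℝ, E) x).symm) y :=
    (contDiffAt_comp_symm (n := 1) hxx (hf x)).differentiableAt one_ne_zero
  set f' : E → ℝ := f ∘ (extChartAt 𝓘(ℝ, E) x).symm with hf'
  have hfy : f' y = f x := by simp [hf', hy]
  set k : ℤ := 2 - (Module.finrank ℝ F : ℤ) with hk
  have hne : lam x ≠ 0 := hpos.ne'
  have hzp : HasFDerivAt (fun z ↦ l z ^ k) ((k * l y ^ (k - 1)) • fderiv ℝ l y) y :=
    (hasDerivAt_zpow k (l y) (Or.inl (by rwa [hly]))).comp_hasFDerivAt y hld.hasFDerivAt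
  have hu := hfd.hasFDerivAt.mul hzp
  have hu' : DifferentiableAt ℝ ((fun x ↦ f x * lam x ^ k) ∘ (extChartAt 𝓘(ℝ, E) x).symm) y :=
    hu.differentiableAt
  have hgrad : ∀ v : TangentSpace 𝓘(ℝ, E) x, inner ℝ (grad (fun x ↦ f x * lam x ^ k) x) v
      = f x * ((k * lam x ^ (k - 1)) * fderiv ℝ l y v) + lam x ^ k * fderiv ℝ f' y v := by
    intro v
    rw [inner_grad, mvfderiv_eq_fderiv_comp_symm hu']
    have := DFunLike.congr_fun hu.fderiv v
    rw [hly, hfy] at this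
    exact this
  have hgf : ∀ v : TangentSpace 𝓘(ℝ, E) x, inner ℝ (grad f x) v = fderiv ℝ f' y v := fun v ↦ by
    rw [inner_grad, mvfderiv_eq_fderiv_comp_symm hfd]
  have hsq : ∀ v : E, fderiv ℝ (fun z ↦ l z ^ 2) y v = 2 * lam x * fderiv ℝ l y v := fun v ↦ by
    have := DFunLike.congr_fun (hld.hasFDerivAt.pow 2).fderiv v
    simpa [hly] using this
  -- The horizontal term λ⁻² (1 - n/2) d(λ²) equals (2 - n) λ⁻¹ dλ, the logarithmic derivative of
  -- λ^(2-n). Hence f times it, plus df, is λ^(n-2) d(f λ^(2-n)).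
  have ht := inner_tensionField hφ hconf hlam hx η
  have hsq' := hsq ((differential (E := E) (F := F) φ x).adjoint η)
  simp only [hl, Function.comp_apply] at hsq'
  rw [hsq'] at ht
  rw [fTensionField, inner_add_left, real_inner_smul_left, ht,
    ← ContinuousLinearMap.adjoint_inner_right, ← ContinuousLinearMap.adjoint_inner_right,
    ← ContinuousLinearMap.adjoint_inner_right, hgf, hgrad, zpow_sub_one₀ hne]
  have hkz : lam x ^ k ≠ 0 := zpow_ne_zero k hne
  have hkr : (k : ℝ) = 2 - (Module.finrank ℝ F : ℝ) := by simp [hk]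
  rw [hkr]
  field_simp
  simp only [hl]
  ring

end Key

/-! ### Any two conditions imply the third -/

section Equivalence

variable {E : Type*} [NormedAddCommGroup E] [NormedSpace ℝ E] [FiniteDimensional ℝ E]
  {M : Type*} [TopologicalSpace M] [ChartedSpace E M] [IsManifold 𝓘(ℝ, E) ∞ M]
  [RiemannianBundle (fun x : M ↦ TangentSpace 𝓘(ℝ, E) x)]
  {F : Type*} [NormedAddCommGroup F] [NormedSpace ℝ F] [FiniteDimensional ℝ F]
  {N : Type*} [TopologicalSpace N] [ChartedSpace F N]
  [RiemannianBundle (fun y : N ↦ TangentSpace 𝓘(ℝ, F) y)]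
  {φ : M → N} {lam f : M → ℝ} {x : M}

theorem fiberMeanCurvature_eq (φ : M → N) (x : M) :
    fiberMeanCurvature (E := E) (F := F) φ x
      = (Module.finrank ℝ (verticalSpace (E := E) (F := F) φ x) : ℝ)⁻¹ • fiberTrace E F φ x := rfl

/-- Dividing by the fiber dimension loses nothing: in dimension zero the trace is an empty sum. -/
theorem fiberTrace_eq_zero_iff (φ : M → N) (x : M) :
    fiberTrace E F φ x = 0 ↔ fiberMeanCurvature (E := E) (F := F) φ x = 0 := by
  rw [fiberMeanCurvature_eq, smul_eq_zero, inv_eq_zero, Nat.cast_eq_zero]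
  refine ⟨Or.inr, fun h ↦ h.elim (fun h0 ↦ ?_) id⟩
  have : IsEmpty (Fin (Module.finrank ℝ (verticalSpace (E := E) (F := F) φ x))) := by
    rw [h0]; infer_instance
  exact Finset.sum_of_isEmpty _

theorem fiberTrace_mem_horizontalSpace (φ : M → N) (x : M) :
    fiberTrace E F φ x ∈ horizontalSpace (E := E) (F := F) φ x :=
  Submodule.sum_mem _ fun _ _ ↦ Submodule.starProjection_apply_mem _ _

/-- The trace is horizontal; if it is also vertical, it is orthogonal to itself. -/
theorem differential_fiberTrace_eq_zero_iff (φ : M → N) (x : M) :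
    differential (E := E) (F := F) φ x (fiberTrace E F φ x) = 0
      ↔ fiberMeanCurvature (E := E) (F := F) φ x = 0 := by
  rw [← fiberTrace_eq_zero_iff]
  refine ⟨fun h ↦ ?_, fun h ↦ by rw [h, map_zero]⟩
  exact inner_self_eq_zero.1
    ((fiberTrace_mem_horizontalSpace (E := E) (F := F) φ x) (fiberTrace E F φ x) h)

theorem surjective_differential (hconf : IsHorizontallyWeaklyConformal E F φ)
    (hx : differential (E := E) (F := F) φ x ≠ 0) :
    Function.Surjective (differential (E := E) (F := F) φ x) := fun ξ ↦
  let ⟨w, _, hw⟩ := (hconf x hx).1 (mem_univ ξ)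
  ⟨w, hw⟩

variable [IsManifold 𝓘(ℝ, F) ∞ N]
  [IsContMDiffRiemannianBundle 𝓘(ℝ, E) ∞ E (fun x : M ↦ TangentSpace 𝓘(ℝ, E) x)]
  [IsContMDiffRiemannianBundle 𝓘(ℝ, F) ∞ F (fun y : N ↦ TangentSpace 𝓘(ℝ, F) y)]

theorem fTensionField_eq (hφ : ContMDiff 𝓘(ℝ, E) 𝓘(ℝ, F) 2 φ)
    (hconf : IsHorizontallyWeaklyConformal E F φ) (hlam : IsDilation E F φ lam)
    (hf : ContMDiff 𝓘(ℝ, E) 𝓘(ℝ, ℝ) 1 f) (hx : differential (E := E) (F := F) φ x ≠ 0) :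
    fTensionField (E := E) (F := F) f φ x
      = -f x • differential (E := E) (F := F) φ x (fiberTrace E F φ x)
        + (lam x ^ (2 - (Module.finrank ℝ F : ℤ)))⁻¹ • differential (E := E) (F := F) φ x
            (grad (fun x ↦ f x * lam x ^ (2 - (Module.finrank ℝ F : ℤ))) x) := by
  refine ext_inner_right ℝ fun η ↦ ?_
  rw [inner_fTensionField hφ hconf hlam hf hx, inner_add_left, real_inner_smul_left,
    real_inner_smul_left]

theorem hasMinimalFibers_of_isFHarmonicMap (hφ : ContMDiff 𝓘(ℝ, E) 𝓘(ℝ, F) 2 φ)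
    (hconf : IsHorizontallyWeaklyConformal E F φ) (hlam : IsDilation E F φ lam)
    (hf : ContMDiff 𝓘(ℝ, E) 𝓘(ℝ, ℝ) 1 f) (hfpos : ∀ x, 0 < f x) (H : IsFHarmonicMap E F f φ)
    (hgrad : GradIsVertical E F φ (fun x ↦ f x * lam x ^ (2 - (Module.finrank ℝ F : ℤ)))) :
    HasMinimalFibers E F φ := by
  intro x _
  rw [← differential_fiberTrace_eq_zero_iff]
  -- Minimality is tested wherever dφ is surjective, which includes dφ = 0 when N has dimension
  -- zero.
  by_cases hx : differential (E := E) (F := F) φ x = 0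
  · rw [hx]
    rfl
  · have h := fTensionField_eq hφ hconf hlam hf hx
    rw [H x, differential_eq_zero_of_mem (hgrad x hx), smul_zero, add_zero] at h
    exact (smul_eq_zero.1 h.symm).resolve_left (neg_ne_zero.2 (hfpos x).ne')

theorem gradIsVertical_of_isFHarmonicMap (hφ : ContMDiff 𝓘(ℝ, E) 𝓘(ℝ, F) 2 φ)
    (hconf : IsHorizontallyWeaklyConformal E F φ) (hlam : IsDilation E F φ lam)
    (hf : ContMDiff 𝓘(ℝ, E) 𝓘(ℝ, ℝ) 1 f) (H : IsFHarmonicMap E F f φ)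
    (hmin : HasMinimalFibers E F φ) :
    GradIsVertical E F φ (fun x ↦ f x * lam x ^ (2 - (Module.finrank ℝ F : ℤ))) := by
  intro x hx
  have h := fTensionField_eq hφ hconf hlam hf hx
  rw [H x, (differential_fiberTrace_eq_zero_iff φ x).2
    (hmin x (surjective_differential hconf hx)), smul_zero, zero_add] at h
  exact (smul_eq_zero.1 h.symm).resolve_left
    (inv_ne_zero (zpow_ne_zero _ ((hlam x).2 hx).1.ne'))

theorem isFHarmonicMap_of_gradIsVertical (hφ : ContMDiff 𝓘(ℝ, E) 𝓘(ℝ, F) 2 φ)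
    (hconf : IsHorizontallyWeaklyConformal E F φ) (hlam : IsDilation E F φ lam)
    (hf : ContMDiff 𝓘(ℝ, E) 𝓘(ℝ, ℝ) 1 f)
    (hgrad : GradIsVertical E F φ (fun x ↦ f x * lam x ^ (2 - (Module.finrank ℝ F : ℤ))))
    (hmin : HasMinimalFibers E F φ) :
    IsFHarmonicMap E F f φ := by
  have hreg : ∀ x, differential (E := E) (F := F) φ x ≠ 0 →
      fTensionField (E := E) (F := F) f φ x = 0 := fun x hx ↦ by
    rw [fTensionField_eq hφ hconf hlam hf hx, differential_eq_zero_of_mem (hgrad x hx),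
      (differential_fiberTrace_eq_zero_iff φ x).2 (hmin x (surjective_differential hconf hx)),
      smul_zero, smul_zero, add_zero]
  intro x
  -- Either x is a limit of regular points (possibly regular itself), or dφ vanishes on a
  -- neighborhood of x.
  by_cases h : ∃ᶠ q in 𝓝 x, differential (E := E) (F := F) φ q ≠ 0
  · exact fTensionField_eq_zero_of_frequently hφ hf (h.mono hreg)
  · refine fTensionField_eq_zero_of_eventually_const hφ ?_
    simpa [Filter.not_frequently] using h

end Equivalence

end FHarmonic

theorem mainTheorem2
    {E : Type*} [NormedAddCommGroup E] [NormedSpace ℝ E] [FiniteDimensional ℝ E]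
    {M : Type*} [TopologicalSpace M] [ChartedSpace E M] [IsManifold 𝓘(ℝ, E) ∞ M]
    [RiemannianBundle (fun x : M ↦ TangentSpace 𝓘(ℝ, E) x)]
    [IsContMDiffRiemannianBundle 𝓘(ℝ, E) ∞ E (fun x : M ↦ TangentSpace 𝓘(ℝ, E) x)]
    {F : Type*} [NormedAddCommGroup F] [NormedSpace ℝ F] [FiniteDimensional ℝ F]
    {N : Type*} [TopologicalSpace N] [ChartedSpace F N] [IsManifold 𝓘(ℝ, F) ∞ N]
    [RiemannianBundle (fun y : N ↦ TangentSpace 𝓘(ℝ, F) y)]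
    [IsContMDiffRiemannianBundle 𝓘(ℝ, F) ∞ F (fun y : N ↦ TangentSpace 𝓘(ℝ, F) y)]
    (φ : M → N) (hφ : ContMDiff 𝓘(ℝ, E) 𝓘(ℝ, F) ∞ φ)
    (hconf : FHarmonic.IsHorizontallyWeaklyConformal E F φ)
    (lam : M → ℝ) (hlam : FHarmonic.IsDilation E F φ lam)
    (f : M → ℝ) (hf : ContMDiff 𝓘(ℝ, E) 𝓘(ℝ, ℝ) ∞ f) (hfpos : ∀ x, 0 < f x) :
    (FHarmonic.IsFHarmonicMap E F f φ → FHarmonic.IsFHarmonicMorphism E F f φ) ∧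
    (FHarmonic.IsFHarmonicMap E F f φ →
      FHarmonic.GradIsVertical E F φ
        (fun x ↦ f x * lam x ^ (2 - (Module.finrank ℝ F : ℤ))) →
      FHarmonic.HasMinimalFibers E F φ) ∧
    (FHarmonic.IsFHarmonicMap E F f φ →
      FHarmonic.HasMinimalFibers E F φ →
      FHarmonic.GradIsVertical E F φ
        (fun x ↦ f x * lam x ^ (2 - (Module.finrank ℝ F : ℤ)))) ∧
    (FHarmonic.GradIsVertical E F φ
        (fun x ↦ f x * lam x ^ (2 - (Module.finrank ℝ F : ℤ))) →
      FHarmonic.HasMinimalFibers E F φ →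
      FHarmonic.IsFHarmonicMap E F f φ) := by
  have hφ2 : ContMDiff 𝓘(ℝ, E) 𝓘(ℝ, F) 2 φ := hφ.of_le ENat.LEInfty.out
  have hf1 : ContMDiff 𝓘(ℝ, E) 𝓘(ℝ, ℝ) 1 f := hf.of_le ENat.LEInfty.out
  exact ⟨FHarmonic.isFHarmonicMorphism_of_isFHarmonicMap hφ hconf hlam,
    FHarmonic.hasMinimalFibers_of_isFHarmonicMap hφ2 hconf hlam hf1 hfpos,
    FHarmonic.gradIsVertical_of_isFHarmonicMap hφ2 hconf hlam hf1,
    FHarmonic.isFHarmonicMap_of_gradIsVertical hφ2 hconf hlam hf1⟩
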